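/- **Setting.** Let $E$ be a finite-dimensional real normed space with dual norm $\|\cdot\|_*$ on $E^*$, $B$ its closed unit ball and $B_R(z)$ the closed ball of radius $R$ about $z$. Let $Q\subset E$ be closed and convex, and let $f:Q\to\mathbb R$ be uniformly convex with parameters $\rho\ge 2$, $\mu=\mu(f)>0$: for all $x,y\in Q$, $a\in[0,1]$, $$f(ax+(1-a)y)\le af(x)+(1-a)f(y)-\tfrac12\mu a(1-a)\big[a^{\rho-1}+(1-a)^{\rho-1}\big]\|x-y\|^\rho .$$ For $x\in Q$ let $\partial f(x)$ be the set of $g\in E^*$ with $\|g\|_*\le L$ and $f(y)\ge f(x)+\langle g,y-x\rangle$ for all $y\in Q$; assume $\partial f(x)\ne\emptyset$ for every $x\in Q$. Let $x^*$ be a minimizer of $f$ on $Q$, $f^*=f(x^*)$, $x_0\in Q$ and $R_0>0$ with $\|x^*-x_0\|\le R_0$. Let $d$ be a prox-function of $B$: $d$ is continuous on $B$ and uniformly convex on $B$ with parameters $2$ and $\mu(d)>0$, $d(0)=0$, and $0\le d\le A(d)$ on $B$. **Oracle.** Let $(\mathcal F_t)_{t\ge -1}$ be a filtration on a probability space. The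 call number $t=0,1,\dots$ of the oracle, made at $x_t$, returns an integrable $g_t=G(x_t,\omega_t)\in E^*$, where $G$ is measurable and $\omega_t$ is $\mathcal F_t$-measurable. It is unbiased, $f'(x_t):=\mathbf E[g_t\mid\mathcal F_{t-1}]\in\partial f(x_t)$ a.s., and for $\xi_t=g_t-f'(x_t)$ and some $\sigma>0$ one has $\mathbf E[\exp(\|\xi_t\|_*^2/\sigma^2)\mid\mathcal F_{t-1}]\le e$ a.s., for every call made by the scheme below. **Scheme** (it uses $L,\sigma,R_0,N,\mu(d),A(d)$, but neither $\rho$ nor $\mu$). Let $N\ge4$, $$m=\Big\lfloor\tfrac12\log_2\frac{\mu(d)N}{A(d)\log_2N}\Big\rfloor-1,\qquad N_0=\lfloor N/m\rfloor,\qquad R_k=2^{-k}R_0,$$ and assume $m\ge1$. Put $y_0=x_0$. At stage $k=1,\dots,m$, let $z=y_{k-1}$, $R=R_{k-1}$, $\beta=R\sqrt{\frac{L^2+\sigma^2}{2\mu(d)A(d)}}\,\sqrt{N_0+1}$; starting from $x_0^{(k)}=z$ and $s_0=0$, put for $i\ge 0$ $$s_{i+1}=s_i+g\big(x_i^{(k)}\big),\qquad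 x^{(k)}_{i+1}=\mathop{\rm argmax}_{x\in Q\cap B_R(z)}\big\{\langle -s_{i+1},x-z\rangle-\beta\, d((x-z)/R)\big\},$$ where $g(x_i^{(k)})$ is the answer to the oracle call made at $x_i^{(k)}$, and set $y_k=\frac1{N_0+1}\sum_{i=0}^{N_0}x^{(k)}_i$. The output is $\widehat x_N=y_m$. **Theorem.** Let $\alpha>0$ and $$S_\alpha=\sqrt{\frac{(L^2+\sigma^2)A(d)}{2\mu(d)}}+\sigma\sqrt{3\ln\Big(\frac{\log_2N}{2\alpha}\Big)},\qquad a=\frac{2}{\sqrt{N_0+1}}\,S_\alpha,$$ $$\varepsilon(N,\alpha)=4\left(\frac{16}{(N_0+1)\,\mu^{2/\rho}}\right)^{\frac{\rho}{2(\rho-1)}}S_\alpha^{\frac{\rho}{\rho-1}},\qquad \mu_k=2^{(\rho-1)k}\cdot 2R_0^{1-\rho}a .$$ (For $\alpha\ge1$ the claims below are trivial, and the square root of a negative number is read as $0$.) 1. If $\mu\le\mu_{m+2}$, then ${\rm Prob}\big[f(\widehat x_N)-f^*\le\varepsilon(N,\alpha)\big]\ge1-\alpha$. 2. If $\mu>\mu_{m+2}$,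 then ${\rm Prob}\big[f(\widehat x_N)-f^*\le 2^{1-m}R_0\,a\big]\ge1-\alpha$. (As $\varepsilon(N,\alpha)$ for $\mu=\mu_{m+2}$ is equal to $2^{1-m}R_0a$, the two parts say together that the bound $\varepsilon(N,\alpha)$ holds with $\min\{\mu,\mu_{m+2}\}$ in the place of $\mu$.) -/

import Mathlib

open MeasureTheory ProbabilityTheory Metric

noncomputable section

/-- `f` is uniformly convex on the convex set `Q` with convexity parameters `ρ` and `μ`
(strongly convex if `ρ = 2`). -/
def UniformlyConvexOn {E : Type*} [NormedAddCommGroup E] [NormedSpace ℝ E]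
    (Q : Set E) (f : E → ℝ) (ρ μ : ℝ) : Prop :=
  Convex ℝ Q ∧ ∀ x ∈ Q, ∀ y ∈ Q, ∀ a : ℝ, 0 ≤ a → a ≤ 1 →
    f (a • x + (1 - a) • y) ≤ a * f x + (1 - a) * f y
      - 1 / 2 * μ * a * (1 - a) * (a ^ (ρ - 1) + (1 - a) ^ (ρ - 1)) * ‖x - y‖ ^ ρ

/-- The subgradients of `f : Q → ℝ` at `x` whose dual norm is at most `L`.  (The bound is part of
the definition because at a boundary point of `Q` the normal cone of `Q` may be added to
any subgradient.) -/
def boundedSubdifferential {E : Type*} [NormedAddCommGroup E] [NormedSpace ℝ E]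
    (Q : Set E) (f : E → ℝ) (L : ℝ) (x : E) : Set (E →L[ℝ] ℝ) :=
  {g | ‖g‖ ≤ L ∧ ∀ y ∈ Q, f x + g (y - x) ≤ f y}

/-- `d` is a prox-function of the unit ball, with parameter `μd` of strong convexity,
bounded by `A` on the ball. -/
structure IsProxFunction {E : Type*} [NormedAddCommGroup E] [NormedSpace ℝ E]
    (d : E → ℝ) (μd A : ℝ) : Prop where
  continuousOn : ContinuousOn d (closedBall 0 1)
  pos : 0 < μd
  stronglyConvex : UniformlyConvexOn (closedBall 0 1) d 2 μd
  zero : d 0 = 0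
  nonneg : ∀ x ∈ closedBall (0 : E) 1, 0 ≤ d x
  le : ∀ x ∈ closedBall (0 : E) 1, d x ≤ A

/-- The prox-mapping `π_{z,R,β}(s)`: the maximizer of `⟨s, x - z⟩ - β d((x - z) / R)` over
`Q ∩ B_R(z)`. -/
def proxMap {E : Type*} [NormedAddCommGroup E] [NormedSpace ℝ E]
    (Q : Set E) (d : E → ℝ) (z : E) (R β : ℝ) (s : E →L[ℝ] ℝ) : E :=
  Classical.epsilon fun x => x ∈ Q ∩ closedBall z R ∧
    IsMaxOn (fun y => s (y - z) - β * d (R⁻¹ • (y - z))) (Q ∩ closedBall z R) x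

/-- Dual averaging with unit weights and constant `β`, on `Q ∩ B_R(z)`: the pair `(s_i, x_i)`,
where `q i x` is the answer of the oracle to the `i`-th call, made at the point `x`. -/
def dualAveraging {E : Type*} [NormedAddCommGroup E] [NormedSpace ℝ E]
    (Q : Set E) (d : E → ℝ) (z : E) (R β : ℝ) (q : ℕ → E → (E →L[ℝ] ℝ)) :
    ℕ → (E →L[ℝ] ℝ) × E
  | 0 => (0, z)
  | i + 1 =>
    let p := dualAveraging Q d z R β q i
    let s := p.1 + q i p.2
    (s, proxMap Q d z R β (-s))

/-- The approximate solution `x_n(z, R)`: the mean of the points `x_0, …, x_n` of dual averaging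
with `β = γ √(n + 1)`. -/
def dualAveragingOutput {E : Type*} [NormedAddCommGroup E] [NormedSpace ℝ E]
    (Q : Set E) (d : E → ℝ) (z : E) (R γ : ℝ) (n : ℕ) (q : ℕ → E → (E →L[ℝ] ℝ)) : E :=
  ((n : ℝ) + 1)⁻¹ • ∑ i ∈ Finset.range (n + 1),
    (dualAveraging Q d z R (γ * √((n : ℝ) + 1)) q i).2

/-- Everything the adaptive multistage scheme is allowed to know; the convexity parameters of the
objective are not among these data. -/
structure AdaptiveScheme (E : Type*) where
  /-- the feasible set -/
  Q : Set E
  /-- the prox-function of the unit ball, its parameter of strong convexity and its bound -/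
  d : E → ℝ
  μd : ℝ
  A : ℝ
  /-- bound on the subgradients -/
  L : ℝ
  /-- noise level -/
  σ : ℝ
  /-- initial point, and bound on its distance to the minimizer -/
  x₀ : E
  R₀ : ℝ
  /-- budget -/
  N : ℕ

namespace AdaptiveScheme

variable {E : Type*} [NormedAddCommGroup E] [NormedSpace ℝ E]

/-- The number of stages, `m = [½ log₂ (μ(d) N / (A(d) log₂ N))] - 1`. -/
def m (S : AdaptiveScheme E) : ℕ :=
  (⌊1 / 2 * Real.logb 2 (S.μd * S.N / (S.A * Real.logb 2 S.N))⌋ - 1).toNat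

/-- The length `N₀ = [N / m]` of a stage. -/
def N₀ (S : AdaptiveScheme E) : ℕ := S.N / S.m

/-- The radius `R_k = 2^{-k} R₀`. -/
def R (S : AdaptiveScheme E) (k : ℕ) : ℝ := S.R₀ / 2 ^ k

/-- The gain of the stage that is run with radius `R_k` (this is stage `k + 1`). -/
def γ (S : AdaptiveScheme E) (k : ℕ) : ℝ :=
  S.R k * √((S.L ^ 2 + S.σ ^ 2) / (2 * S.μd * S.A))

/-- The points `y_0, y_1, …` produced by the stages.  The oracle calls are numbered consecutively
through all stages, `N₀ + 1` per stage; `q t x` is the answer to the call number `t`, made at `x`. -/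
def y (S : AdaptiveScheme E) (q : ℕ → E → (E →L[ℝ] ℝ)) : ℕ → E
  | 0 => S.x₀
  | k + 1 => dualAveragingOutput S.Q S.d (S.y q k) (S.R k) (S.γ k) S.N₀
      fun i => q (k * (S.N₀ + 1) + i)

/-- The output `y_m` of the scheme. -/
def output (S : AdaptiveScheme E) (q : ℕ → E → (E →L[ℝ] ℝ)) : E := S.y q S.m

/-- The search point at which the oracle call number `t` is made. -/
def searchPoint (S : AdaptiveScheme E) (q : ℕ → E → (E →L[ℝ] ℝ)) (t : ℕ) : E :=
  let k := t / (S.N₀ + 1)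
  (dualAveraging S.Q S.d (S.y q k) (S.R k) (S.γ k * √((S.N₀ : ℝ) + 1))
    (fun i => q (k * (S.N₀ + 1) + i)) (t % (S.N₀ + 1))).2

/-- The factor `√((L² + σ²) A(d) / (2 μ(d))) + σ √(3 ln (log₂ N / (2 α)))`. -/
def noiseFactor (S : AdaptiveScheme E) (α : ℝ) : ℝ :=
  √((S.L ^ 2 + S.σ ^ 2) * S.A / (2 * S.μd))
    + S.σ * √(3 * Real.log (Real.logb 2 S.N / (2 * α)))

/-- The accuracy per unit radius of one stage, `a = 2 (N₀ + 1)^{-1/2} · noiseFactor`. -/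
def stageAccuracy (S : AdaptiveScheme E) (α : ℝ) : ℝ :=
  2 / √((S.N₀ : ℝ) + 1) * S.noiseFactor α

/-- The accuracy `ε(N, α)` of the scheme for convexity parameters `ρ`, `μ`. -/
def accuracy (S : AdaptiveScheme E) (ρ μ α : ℝ) : ℝ :=
  4 * (16 / (((S.N₀ : ℝ) + 1) * μ ^ (2 / ρ))) ^ (ρ / (2 * (ρ - 1)))
    * S.noiseFactor α ^ (ρ / (ρ - 1))

variable {Ω Z : Type*} [MeasurableSpace Ω] [MeasurableSpace Z]

/-- The search point `x_t` as a random element, when the oracle answers `G x (ζ t)` to the call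
number `t` made at `x`. -/
def randomPoint (S : AdaptiveScheme E) (G : E → Z → (E →L[ℝ] ℝ)) (ζ : ℕ → Ω → Z)
    (t : ℕ) (w : Ω) : E :=
  S.searchPoint (fun j x => G x (ζ j w)) t

/-- The observation `g_t = G (x_t) (ζ_t)`. -/
def observation (S : AdaptiveScheme E) (G : E → Z → (E →L[ℝ] ℝ)) (ζ : ℕ → Ω → Z)
    (t : ℕ) (w : Ω) : E →L[ℝ] ℝ :=
  G (S.randomPoint G ζ t w) (ζ t w)

/-- The stochastic perturbation `ξ_t = g_t - E[g_t | past]`. -/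
def noise (S : AdaptiveScheme E) (P : Measure Ω) (ℱ : Filtration ℕ ‹MeasurableSpace Ω›)
    (G : E → Z → (E →L[ℝ] ℝ)) (ζ : ℕ → Ω → Z) (t : ℕ) (w : Ω) : E →L[ℝ] ℝ :=
  S.observation G ζ t w - (P[S.observation G ζ t | ℱ t]) w

/-- An unbiased stochastic first order oracle for `f` with sub-Gaussian noise of level `σ`, along
the run of the scheme (which makes `m (N₀ + 1)` calls).  `ℱ t` is the information available before
the call number `t`, and `ζ t` is the random parameter of that call. -/
structure IsOracle [MeasurableSpace E] (S : AdaptiveScheme E)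
    (f : E → ℝ) (P : Measure Ω) (ℱ : Filtration ℕ ‹MeasurableSpace Ω›)
    (G : E → Z → (E →L[ℝ] ℝ)) (ζ : ℕ → Ω → Z) : Prop where
  measurable : StronglyMeasurable (Function.uncurry G)
  adapted : ∀ t, Measurable[ℱ (t + 1)] (ζ t)
  integrable : ∀ t < S.m * (S.N₀ + 1), Integrable (S.observation G ζ t) P
  unbiased : ∀ t < S.m * (S.N₀ + 1), ∀ᵐ w ∂P,
    (P[S.observation G ζ t | ℱ t]) w
      ∈ boundedSubdifferential S.Q f S.L (S.randomPoint G ζ t w)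
  integrable_exp : ∀ t < S.m * (S.N₀ + 1),
    Integrable (fun w => Real.exp (‖S.noise P ℱ G ζ t w‖ ^ 2 / S.σ ^ 2)) P
  subGaussian : ∀ t < S.m * (S.N₀ + 1), ∀ᵐ w ∂P,
    (P[fun v => Real.exp (‖S.noise P ℱ G ζ t v‖ ^ 2 / S.σ ^ 2) | ℱ t]) w ≤ Real.exp 1

end AdaptiveScheme

end

/-! The argument separates into a deterministic tracking of the distances to the minimizer $x^*$ and
a large-deviation bound for a single stage.

Tracking. Say that stage $j+1$ (radius $R_j$) succeeds if $f(y_{j+1})-f(c_j)\le R_ja$, where the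
comparator $c_j$ is $x^*$ if $\|x^*-y_j\|\le R_j$, and $y_j$ otherwise. Uniform convexity gives
$\frac12\mu\|y-x^*\|^\rho\le f(y)-f^*$, so a successful stage that starts within $R_j$ of $x^*$ ends
within $R_j/2$ of it, as long as $R_j$ is not too small for $\mu$. Without knowledge of $\mu$ the
scheme keeps halving beyond that point, and $x^*$ may leave the balls. Comparison with $y_j$ then
shows that a later stage increases $f$ by at most $R_ja$, and these losses form a geometric series
dominated by the last good stage (`norm_sub_le_of_two_pow_le`, `sub_le_of_norm_sub_le`,
`sub_le_of_le_two_pow`).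

One stage. In the regret of dual averaging each answer $g_i=f'(x_i)+\xi_i$ is added in two
half-steps (`sum_dualAveraging_le`). The price is $\|f'\|_*^2+\|\xi\|_*^2$, without cross term, and
$\xi_i$ is paired with a point determined before the call. The excess error is therefore a sum of
terms $\tau(Z_i-1)+Y_i$ with $Z_i=\|\xi_i\|_*^2/\sigma^2$, $Y_i$ of conditional mean zero and
$Y_i^2\le4Z_i$. A single Chernoff bound treats both parts together (`exists_chernoff_weights`,
`measure_sum_ge_le`, `measure_stage_fail_le`). A stage fails with probability at most
$2\alpha/\log_2N$, and there are at most $\frac12\log_2N$ stages. -/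

noncomputable section

/-! ### Exponential inequalities behind the Chernoff bound. -/

/-- The linear term disappears under expectation of a centered variable, which leaves a moment bound
of second order. The constant 7/10 is just small enough for the factor 3 in `exp_le_of_small`. -/
theorem Real.exp_le_self_add_exp_sq (x : ℝ) : Real.exp x ≤ x + Real.exp (7 / 10 * x ^ 2) := by
  rcases le_total x 0 with hx | hx
  · have h1 : 1 + 7 / 10 * x ^ 2 ≤ Real.exp (7 / 10 * x ^ 2) := by
      linarith [Real.add_one_le_exp (7 / 10 * x ^ 2)]
    have h2 : Real.exp x * (1 - x + x ^ 2 / 2) ≤ 1 := by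
      have := Real.quadratic_le_exp_of_nonneg (x := -x) (by linarith)
      have e : Real.exp x * Real.exp (-x) = 1 := by rw [← Real.exp_add]; simp
      nlinarith [Real.exp_pos x]
    have h3 : Real.exp x ≤ 1 + x + 7 / 10 * x ^ 2 := by
      by_contra! h
      have : 0 < 1 - x + x ^ 2 / 2 := by nlinarith
      nlinarith [mul_lt_mul_of_pos_right h this, pow_nonneg (sq_nonneg x) 2, sq_nonneg x,
        mul_nonneg (neg_nonneg.2 hx) (sq_nonneg x)]
    linarith
  · rcases le_total x 2 with h2 | h2
    -- Halving brings the argument into [0, 1], where the Taylor bound with remainder applies; 2/9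
    -- is its constant 4/(3!·3).
    · set y := x / 2 with hy
      have hxy : x = 2 * y := by ring
      have hy0 : 0 ≤ y := by linarith
      have hy1 : y ≤ 1 := by linarith
      have h1 : Real.exp y ≤ 1 + y + y ^ 2 / 2 + 2 * y ^ 3 / 9 := by
        have := Real.exp_bound' hy0 hy1 (n := 3) (by norm_num)
        simp [Finset.sum_range_succ, Nat.factorial] at this
        linarith
      have h3 : Real.exp x = Real.exp y ^ 2 := by
        rw [← Real.exp_nat_mul, hxy]; norm_num
      have h4 : 1 + 7 / 10 * x ^ 2 + (7 / 10 * x ^ 2) ^ 2 / 2 ≤ Real.exp (7 / 10 * x ^ 2) :=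
        Real.quadratic_le_exp_of_nonneg (by positivity)
      have h5 : Real.exp y ^ 2 ≤ (1 + y + y ^ 2 / 2 + 2 * y ^ 3 / 9) ^ 2 :=
        pow_le_pow_left₀ (Real.exp_pos y).le h1 2
      have h6 : (1 + y + y ^ 2 / 2 + 2 * y ^ 3 / 9) ^ 2
          ≤ x + (1 + 7 / 10 * x ^ 2 + (7 / 10 * x ^ 2) ^ 2 / 2) := by
        rw [hxy]
        have h7 : 13 / 9 * y + 25 / 36 * y ^ 2 + 2 / 9 * y ^ 3 + 4 / 81 * y ^ 4
            ≤ 4 / 5 + 392 / 100 * y ^ 2 := by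
          have a1 : y ^ 3 ≤ y ^ 2 := pow_le_pow_of_le_one hy0 hy1 (by norm_num)
          have a2 : y ^ 4 ≤ y ^ 2 := pow_le_pow_of_le_one hy0 hy1 (by norm_num)
          nlinarith [sq_nonneg (y - 1 / 4)]
        nlinarith [mul_le_mul_of_nonneg_left h7 (sq_nonneg y)]
      linarith
    · have : Real.exp x ≤ Real.exp (7 / 10 * x ^ 2) := Real.exp_le_exp.2 (by nlinarith)
      linarith

/-- Pointwise bound on `exp (l (τ (Z - 1) + Y))` that is linear in `exp Z` and `Y`, for small `l`
and `τ`: it gives `E exp (l (τ (Z - 1) + Y)) ≤ exp (3 l²)` if `E exp Z ≤ e` and `E Y = 0`. -/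
theorem exp_le_of_small (l τ : ℝ) (hl0 : 0 ≤ l) (hl : l ≤ 1 / 2) (hτ0 : 0 ≤ τ) (hτ : τ ≤ 1 / 8) :
    ∃ C₀ C₁ C₂ : ℝ, 0 ≤ C₀ ∧ 0 ≤ C₁ ∧ C₀ + C₁ * Real.exp 1 ≤ Real.exp (3 * l ^ 2) ∧
      ∀ Y Z : ℝ, Y ^ 2 ≤ 4 * Z → Real.exp (l * (τ * (Z - 1) + Y))
        ≤ C₀ + C₁ * Real.exp Z + C₂ * Y := by
  -- The exponent is written as `-(p * w)` plus the convex combination, with weights `p` and `1 -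
  -- p`, of `Z - 1 + w` and `k * Y`. The shift `w` makes both exponentials have expectation at most
  -- `exp w`, so that the total is `exp ((1 - p) * w)`.
  set p := l * τ with hp
  have hp0 : 0 ≤ p := by positivity
  have hp1 : p ≤ 1 / 16 := by nlinarith
  have hq : 0 < 1 - p := by linarith
  set k := l / (1 - p) with hk
  have hk0 : 0 ≤ k := by positivity
  have hk1 : k ≤ 8 / 15 := by rw [hk, div_le_iff₀ hq]; linarith
  -- 14/5 = 4 · 7/10: the constant of `Real.exp_le_self_add_exp_sq` combined with `Y ^ 2 ≤ 4 * Z`.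
  set w := 14 / 5 * k ^ 2 with hw
  have hw0 : 0 ≤ w := by positivity
  have hw1 : w ≤ 1 := by nlinarith
  have hfin : (1 - p) * w ≤ 3 * l ^ 2 := by
    have e : l = k * (1 - p) := by rw [hk]; field_simp
    rw [e, hw]
    have : 0 ≤ k ^ 2 * (1 - p) := by positivity
    nlinarith
  have e1 : Real.exp (-1) * Real.exp 1 = 1 := by rw [← Real.exp_add]; simp
  refine ⟨Real.exp (-(p * w)) * ((1 - p) * (Real.exp w * (1 - w))),
    Real.exp (-(p * w)) * (p * Real.exp w + (1 - p) * Real.exp w * w) * Real.exp (-1),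
    Real.exp (-(p * w)) * ((1 - p) * k), ?_, ?_, ?_, ?_⟩
  · have : 0 ≤ 1 - w := by linarith
    positivity
  · positivity
  · have : Real.exp (-(p * w)) * ((1 - p) * (Real.exp w * (1 - w)))
        + Real.exp (-(p * w)) * (p * Real.exp w + (1 - p) * Real.exp w * w) * Real.exp (-1)
          * Real.exp 1 = Real.exp ((1 - p) * w) := by
      rw [mul_assoc _ (Real.exp (-1)), e1]
      have : Real.exp ((1 - p) * w) = Real.exp (-(p * w)) * Real.exp w := by
        rw [← Real.exp_add]; congr 1; ring
      rw [this]; ring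
    rw [this]
    exact Real.exp_le_exp.2 hfin
  · intro Y Z hYZ
    have hconv := convexOn_exp.2 (Set.mem_univ (Z - 1 + w)) (Set.mem_univ (k * Y)) hp0 hq.le
      (by ring)
    simp only [smul_eq_mul] at hconv
    have e2 : l * (τ * (Z - 1) + Y) = -(p * w) + (p * (Z - 1 + w) + (1 - p) * (k * Y)) := by
      have : (1 - p) * k = l := by rw [hk]; field_simp
      linear_combination (-Y) * this
    have h1 := Real.exp_le_self_add_exp_sq (k * Y)
    have h2 : Real.exp (7 / 10 * (k * Y) ^ 2) ≤ Real.exp (w * Z) := by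
      refine Real.exp_le_exp.2 ?_
      rw [hw]
      nlinarith [mul_le_mul_of_nonneg_left hYZ (sq_nonneg k)]
    have h3 : Real.exp (w * Z) ≤ Real.exp w * (w * Real.exp (Z - 1) + (1 - w)) := by
      have := convexOn_exp.2 (Set.mem_univ (Z - 1)) (Set.mem_univ 0) hw0
        (by linarith : 0 ≤ 1 - w) (by ring)
      simp only [smul_eq_mul, mul_zero, add_zero, Real.exp_zero, mul_one] at this
      have e : w * Z = w + w * (Z - 1) := by ring
      rw [e, Real.exp_add]
      exact mul_le_mul_of_nonneg_left this (Real.exp_pos _).le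
    have e3 : Real.exp (Z - 1 + w) = Real.exp Z * Real.exp (-1) * Real.exp w := by
      rw [← Real.exp_add, ← Real.exp_add]; congr 1
    have e4 : Real.exp (Z - 1) = Real.exp Z * Real.exp (-1) := by
      rw [← Real.exp_add]; congr 1
    rw [e2, Real.exp_add]
    rw [e3] at hconv
    rw [e4] at h3
    have h4 := mul_le_mul_of_nonneg_left (h1.trans (add_le_add_right (h2.trans h3) (k * Y))) hq.le
    have h5 := mul_le_mul_of_nonneg_left (hconv.trans (add_le_add_right h4 _))
      (Real.exp_pos (-(p * w))).le
    refine h5.trans (le_of_eq ?_)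
    ring

/-- Weights of a Chernoff bound for sums of `τ (Z - 1) + Y`. -/
theorem exists_chernoff_weights {n : ℕ} (hn : 0 < n) {ℓ τ : ℝ} (hℓ : 0 < ℓ) (hτ0 : 0 ≤ τ)
    (hτ : τ ≤ 1 / 8) (hτℓ : τ ^ 2 * ℓ ≤ n / 192) :
    ∃ l C₀ C₁ C₂ : ℝ, 0 < l ∧ 0 ≤ C₀ ∧ 0 ≤ C₁ ∧
      (C₀ + C₁ * Real.exp 1) ^ n ≤ Real.exp (l * (2 * √(3 * n * ℓ)) - ℓ) ∧
      ∀ Y Z : ℝ, Y ^ 2 ≤ 4 * Z → Real.exp (l * (τ * (Z - 1) + Y))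
        ≤ C₀ + C₁ * Real.exp Z + C₂ * Y := by
  have hn' : (0 : ℝ) < n := by exact_mod_cast hn
  -- For moderate `ℓ`, `l` minimizes `3 n l² - 2 l √(3 n ℓ)`; it satisfies `l ≤ 1/2` exactly when `ℓ
  -- ≤ 3 n / 4`. For larger `ℓ` centering is not needed, and the exponent is bounded by `Z + 12/11
  -- l²`.
  rcases le_total ℓ (3 / 4 * n) with h | h
  · set l := √(ℓ / (3 * n)) with hl
    have hl0 : 0 < l := Real.sqrt_pos.2 (by positivity)
    have hl2 : l ^ 2 = ℓ / (3 * n) := Real.sq_sqrt (by positivity)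
    have hl1 : l ≤ 1 / 2 := by
      rw [hl, Real.sqrt_le_left (by norm_num), div_le_iff₀ (by positivity)]
      linarith
    obtain ⟨C₀, C₁, C₂, h0, h1, h2, h3⟩ := exp_le_of_small l τ hl0.le hl1 hτ0 hτ
    refine ⟨l, C₀, C₁, C₂, hl0, h0, h1, ?_, h3⟩
    have e1 : √(3 * n * ℓ) = l * (3 * n) := by
      rw [Real.sqrt_eq_iff_mul_self_eq (by positivity) (by positivity)]
      have : l * (3 * n) * (l * (3 * n)) = l ^ 2 * (3 * n) ^ 2 := by ring
      rw [this, hl2]; field_simp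
    have e2 : l * (2 * √(3 * n * ℓ)) - ℓ = n * (3 * l ^ 2) := by
      have : ℓ = l ^ 2 * (3 * n) := by rw [hl2]; field_simp
      rw [e1]; linear_combination -this
    rw [e2, Real.exp_nat_mul]
    exact pow_le_pow_left₀ (by positivity) h2 n
  · set l := √(ℓ / n) with hl
    have hl0 : 0 < l := Real.sqrt_pos.2 (by positivity)
    have hl2 : l ^ 2 = ℓ / n := Real.sq_sqrt (by positivity)
    have hlτ : l * τ ≤ 1 / 12 := by
      have : (l * τ) ^ 2 ≤ 1 / 192 := by
        rw [mul_pow, hl2, div_mul_eq_mul_div, div_le_iff₀ hn']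
        linarith
      exact abs_le_of_sq_le_sq' (by linarith) (by norm_num) |>.2
    refine ⟨l, 0, Real.exp (12 / 11 * l ^ 2), 0, hl0, le_rfl, (Real.exp_pos _).le, ?_, ?_⟩
    · rw [zero_add, ← Real.exp_add, ← Real.exp_nat_mul]
      refine Real.exp_le_exp.2 ?_
      have e1 : √(3 * n * ℓ) = √3 * (n * l) := by
        rw [Real.sqrt_eq_iff_mul_self_eq (by positivity) (by positivity)]
        have : √3 * (n * l) * (√3 * (n * l)) = √3 ^ 2 * (n ^ 2 * l ^ 2) := by ring
        rw [this, hl2, Real.sq_sqrt (by norm_num)]; field_simp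
      have e2 : ℓ = n * l ^ 2 := by rw [hl2]; field_simp
      have e3 : (1.73 : ℝ) ≤ √3 := Real.le_sqrt_of_sq_le (by norm_num)
      have e4 : 3 / 4 ≤ l ^ 2 := by rw [hl2, le_div_iff₀ hn']; linarith
      rw [e1]
      have : 12 / 11 * l ^ 2 + 1 ≤ 2 * √3 * l ^ 2 - l ^ 2 := by nlinarith
      calc _ ≤ n * (2 * √3 * l ^ 2 - l ^ 2) := mul_le_mul_of_nonneg_left this hn'.le
        _ = l * (2 * (√3 * (n * l))) - n * l ^ 2 := by ring
        _ = _ := by rw [← e2]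
    · intro Y Z hYZ
      rw [zero_add, zero_mul, add_zero, ← Real.exp_add]
      refine Real.exp_le_exp.2 ?_
      have hZ : 0 ≤ Z := by nlinarith [sq_nonneg Y]
      have h1 : l * τ * Z ≤ 1 / 12 * Z := mul_le_mul_of_nonneg_right hlτ hZ
      -- Young's inequality gives `l * Y ≤ 12/11 l² + 11/48 Y²`, and the last term is at most `11/12
      -- Z`; the remaining `Z / 12` covers `l * τ * Z`.
      nlinarith [sq_nonneg (Y - 24 / 11 * l), mul_nonneg hl0.le hτ0]

/-! ### Strong convexity, smoothness and continuity of the prox-mapping. -/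

section Prox

variable {E : Type*} [NormedAddCommGroup E] [NormedSpace ℝ E]

theorem UniformlyConvexOn.convexOn {Q : Set E} {f : E → ℝ} {ρ μ : ℝ}
    (h : UniformlyConvexOn Q f ρ μ) (hμ : 0 ≤ μ) : ConvexOn ℝ Q f := by
  refine ⟨h.1, fun x hx y hy a b ha hb hab => ?_⟩
  obtain rfl : b = 1 - a := by linarith
  have key := h.2 x hx y hy a ha (by linarith)
  have : 0 ≤ 1 / 2 * μ * a * (1 - a) * (a ^ (ρ - 1) + (1 - a) ^ (ρ - 1)) * ‖x - y‖ ^ ρ := by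
    have h1 := Real.rpow_nonneg ha (ρ - 1)
    have h2 := Real.rpow_nonneg hb (ρ - 1)
    have h3 := Real.rpow_nonneg (norm_nonneg (x - y)) ρ
    positivity
  simp only [smul_eq_mul]
  linarith

/-- Growth of a uniformly convex function away from its minimizer. -/
theorem UniformlyConvexOn.add_le_of_isMinOn {C : Set E} {φ : E → ℝ} {ρ μ : ℝ}
    (h : UniformlyConvexOn C φ ρ μ) (hρ : 1 < ρ) {x y : E} (hx : x ∈ C) (hmin : IsMinOn φ C x)
    (hy : y ∈ C) : φ x + 1 / 2 * μ * ‖y - x‖ ^ ρ ≤ φ y := by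
  -- Convexity along the segment to the minimizer, divided by `a`. As `a → 0` the bracket tends to
  -- 1, because `ρ > 1` kills `a ^ (ρ - 1)`.
  have key : ∀ a ∈ Set.Ioo (0 : ℝ) 1,
      1 / 2 * μ * (1 - a) * (a ^ (ρ - 1) + (1 - a) ^ (ρ - 1)) * ‖y - x‖ ^ ρ ≤ φ y - φ x := by
    intro a ha
    have h1 := h.2 y hy x hx a ha.1.le ha.2.le
    have h2 : φ x ≤ φ (a • y + (1 - a) • x) :=
      hmin (h.1 hy hx ha.1.le (by linarith [ha.2]) (by ring))
    have h3 : a * (1 / 2 * μ * (1 - a) * (a ^ (ρ - 1) + (1 - a) ^ (ρ - 1)) * ‖y - x‖ ^ ρ)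
        ≤ a * (φ y - φ x) := by linarith
    exact le_of_mul_le_mul_left h3 ha.1
  have hc : ContinuousAt (fun a : ℝ =>
      1 / 2 * μ * (1 - a) * (a ^ (ρ - 1) + (1 - a) ^ (ρ - 1)) * ‖y - x‖ ^ ρ) 0 := by
    have e1 : ContinuousAt (fun a : ℝ => a ^ (ρ - 1)) 0 :=
      (Real.continuous_rpow_const (by linarith)).continuousAt
    have e2 : ContinuousAt (fun a : ℝ => (1 - a) ^ (ρ - 1)) 0 :=
      ((Real.continuous_rpow_const (by linarith)).comp (by fun_prop)).continuousAt
    fun_prop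
  have hlim := hc.tendsto.mono_left (nhdsWithin_le_nhds (s := Set.Ioi 0))
  have := le_of_tendsto hlim
    (Filter.eventually_of_mem (Ioo_mem_nhdsGT zero_lt_one) key)
  simp [Real.zero_rpow (by linarith : ρ - 1 ≠ 0)] at this
  linarith

theorem IsProxFunction.half_mul_sq_le {d : E → ℝ} {μd A : ℝ} (hd : IsProxFunction d μd A) {x : E}
    (hx : x ∈ closedBall (0 : E) 1) : 1 / 2 * μd * ‖x‖ ^ 2 ≤ d x := by
  have := hd.stronglyConvex.add_le_of_isMinOn one_lt_two (x := 0) (by simp)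
    (fun y hy => by simpa [hd.zero] using hd.nonneg y hy) hx
  simpa [hd.zero] using this

theorem IsProxFunction.le_two_mul [Nontrivial E] {d : E → ℝ} {μd A : ℝ}
    (hd : IsProxFunction d μd A) : μd ≤ 2 * A := by
  obtain ⟨x, hx⟩ := exists_norm_eq E zero_le_one
  have hx' : x ∈ closedBall (0 : E) 1 := by simp [hx]
  have h1 := hd.half_mul_sq_le hx'
  have h2 := hd.le x hx'
  rw [hx] at h1
  linarith

/-- The function that the prox-mapping maximizes. -/
def proxObj (d : E → ℝ) (z : E) (R β : ℝ) (s : E →L[ℝ] ℝ) (y : E) : ℝ :=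
  s (y - z) - β * d (R⁻¹ • (y - z))

theorem inv_smul_sub_mem_closedBall {z y : E} {R : ℝ} (hR : 0 < R) (hy : y ∈ closedBall z R) :
    R⁻¹ • (y - z) ∈ closedBall (0 : E) 1 := by
  rw [mem_closedBall, dist_eq_norm] at hy
  rw [mem_closedBall_zero_iff, norm_smul, norm_inv, Real.norm_of_nonneg hR.le,
    inv_mul_le_iff₀ hR]
  linarith

variable {Q : Set E} {d : E → ℝ} {μd A R β : ℝ} {z : E}

theorem uniformlyConvexOn_neg_proxObj (hQc : Convex ℝ Q) (hd : IsProxFunction d μd A)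
    (hR : 0 < R) (hβ : 0 < β) (s : E →L[ℝ] ℝ) :
    UniformlyConvexOn (Q ∩ closedBall z R) (fun y => -proxObj d z R β s y) 2
      (β * μd / R ^ 2) := by
  refine ⟨hQc.inter (convex_closedBall z R), fun x hx y hy a ha ha1 => ?_⟩
  have key := hd.stronglyConvex.2 _ (inv_smul_sub_mem_closedBall hR hx.2) _
    (inv_smul_sub_mem_closedBall hR hy.2) a ha ha1
  have e1 : a • x + (1 - a) • y - z = a • (x - z) + (1 - a) • (y - z) := by module
  have e2 : R⁻¹ • (a • x + (1 - a) • y - z)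
      = a • R⁻¹ • (x - z) + (1 - a) • R⁻¹ • (y - z) := by rw [e1]; module
  have e3 : R⁻¹ • (x - z) - R⁻¹ • (y - z) = R⁻¹ • (x - y) := by module
  have e4 : ‖R⁻¹ • (x - y)‖ ^ 2 = ‖x - y‖ ^ 2 / R ^ 2 := by
    rw [norm_smul, norm_inv, Real.norm_of_nonneg hR.le]
    field_simp
  rw [← e2, e3] at key
  simp only [Real.rpow_ofNat, e4] at key
  simp only [proxObj, Real.rpow_ofNat, e2]
  rw [e2] at key
  rw [e1, map_add, map_smul, map_smul, smul_eq_mul, smul_eq_mul]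
  have := mul_le_mul_of_nonneg_left key hβ.le
  ring_nf at this ⊢
  linarith

theorem continuousOn_proxObj (hd : IsProxFunction d μd A) (hR : 0 < R) (s : E →L[ℝ] ℝ) :
    ContinuousOn (proxObj d z R β s) (closedBall z R) := by
  unfold proxObj
  have : ContinuousOn (fun y => d (R⁻¹ • (y - z))) (closedBall z R) :=
    hd.continuousOn.comp (by fun_prop) fun y hy => inv_smul_sub_mem_closedBall hR hy
  exact (s.continuous.comp (by fun_prop)).continuousOn.sub (continuousOn_const.mul this)

/-- The point of the ball that corresponds to the truncation of the segment from `z` to `y`. -/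
def truncDir (R : ℝ) (z y : E) : E := (max R ‖y - z‖)⁻¹ • (y - z)

theorem truncDir_mem (hR : 0 < R) (z y : E) : truncDir R z y ∈ closedBall (0 : E) 1 := by
  have : 0 < max R ‖y - z‖ := lt_max_of_lt_left hR
  rw [mem_closedBall_zero_iff, truncDir, norm_smul, norm_inv, Real.norm_of_nonneg this.le,
    inv_mul_le_iff₀ this, mul_one]
  exact le_max_right _ _

theorem add_smul_truncDir_mem (hQc : Convex ℝ Q) (hR : 0 < R) (hz : z ∈ Q) {y : E} (hy : y ∈ Q) :
    z + R • truncDir R z y ∈ Q := by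
  have h0 : 0 < max R ‖y - z‖ := lt_max_of_lt_left hR
  have e : z + R • truncDir R z y = z + (R / max R ‖y - z‖) • (y - z) := by
    rw [truncDir, smul_smul, div_eq_mul_inv]
  rw [e]
  exact hQc.add_smul_sub_mem hz hy ⟨by positivity, (div_le_one h0).2 (le_max_left _ _)⟩

theorem truncDir_eq {y : E} (hy : y ∈ closedBall z R) : truncDir R z y = R⁻¹ • (y - z) := by
  rw [mem_closedBall, dist_eq_norm] at hy
  rw [truncDir, max_eq_left hy]

theorem continuous_truncDir (hR : 0 < R) (y : E) : Continuous fun z => truncDir R z y := by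
  unfold truncDir
  have : ∀ z, max R ‖y - z‖ ≠ 0 := fun z => (lt_max_of_lt_left hR).ne'
  exact Continuous.smul (Continuous.inv₀ (by fun_prop) this) (by fun_prop)

section FiniteDim

variable [FiniteDimensional ℝ E]

theorem proxMap_spec (hQ : IsClosed Q) (hd : IsProxFunction d μd A) (hR : 0 < R) (hz : z ∈ Q)
    (s : E →L[ℝ] ℝ) : proxMap Q d z R β s ∈ Q ∩ closedBall z R ∧
      IsMaxOn (proxObj d z R β s) (Q ∩ closedBall z R) (proxMap Q d z R β s) := by
  have := FiniteDimensional.proper ℝ E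
  have hc : IsCompact (Q ∩ closedBall z R) := (isCompact_closedBall z R).inter_left hQ
  obtain ⟨x, hx, hmax⟩ := hc.exists_isMaxOn ⟨z, hz, mem_closedBall_self hR.le⟩
    ((continuousOn_proxObj hd hR (β := β) s).mono Set.inter_subset_right)
  exact Classical.epsilon_spec (p := fun x => x ∈ Q ∩ closedBall z R ∧
    IsMaxOn (proxObj d z R β s) (Q ∩ closedBall z R) x) ⟨x, hx, hmax⟩

/-- Quadratic decrease of the objective away from the prox-mapping. -/
theorem proxObj_add_le (hQ : IsClosed Q) (hQc : Convex ℝ Q) (hd : IsProxFunction d μd A)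
    (hR : 0 < R) (hβ : 0 < β) (hz : z ∈ Q) (s : E →L[ℝ] ℝ) {y : E}
    (hy : y ∈ Q ∩ closedBall z R) :
    proxObj d z R β s y + 1 / 2 * (β * μd / R ^ 2) * ‖y - proxMap Q d z R β s‖ ^ 2
      ≤ proxObj d z R β s (proxMap Q d z R β s) := by
  obtain ⟨h1, h2⟩ := proxMap_spec (β := β) hQ hd hR hz s
  have := (uniformlyConvexOn_neg_proxObj hQc hd hR hβ s).add_le_of_isMinOn one_lt_two h1
    (h2.neg) hy
  simp only [Real.rpow_ofNat] at this
  linarith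

theorem eq_proxMap (hQ : IsClosed Q) (hQc : Convex ℝ Q) (hd : IsProxFunction d μd A)
    (hR : 0 < R) (hβ : 0 < β) (hz : z ∈ Q) (s : E →L[ℝ] ℝ) {y : E}
    (hy : y ∈ Q ∩ closedBall z R) (hmax : IsMaxOn (proxObj d z R β s) (Q ∩ closedBall z R) y) :
    y = proxMap Q d z R β s := by
  have h1 := proxObj_add_le hQ hQc hd hR hβ hz s hy
  have h2 : proxObj d z R β s (proxMap Q d z R β s) ≤ proxObj d z R β s y :=
    hmax (proxMap_spec (β := β) hQ hd hR hz s).1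
  have h3 : 0 < 1 / 2 * (β * μd / R ^ 2) := by have := hd.pos; positivity
  have h4 : ‖y - proxMap Q d z R β s‖ ^ 2 ≤ 0 := by
    by_contra! h
    nlinarith [mul_pos h3 h]
  have h5 : ‖y - proxMap Q d z R β s‖ = 0 := by
    have := sq_nonneg ‖y - proxMap Q d z R β s‖
    exact pow_eq_zero_iff (two_ne_zero) |>.1 (le_antisymm h4 this)
  exact sub_eq_zero.1 (norm_eq_zero.1 h5)

/-- Since `d ≥ 0 = d 0`, the starting point of a stage is itself a prox-point, so the regret
induction needs no separate first step. -/
theorem proxMap_zero (hQ : IsClosed Q) (hQc : Convex ℝ Q) (hd : IsProxFunction d μd A)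
    (hR : 0 < R) (hβ : 0 < β) (hz : z ∈ Q) : proxMap Q d z R β 0 = z := by
  refine (eq_proxMap hQ hQc hd hR hβ hz 0 ⟨hz, mem_closedBall_self hR.le⟩ fun y hy => ?_).symm
  have := hd.nonneg _ (inv_smul_sub_mem_closedBall hR hy.2)
  simp only [proxObj, Set.mem_ofPred_eq, sub_self, smul_zero, hd.zero, map_zero, mul_zero,
    zero_apply]
  have := mul_nonneg hβ.le this
  linarith

/-- The conjugate of the prox-function has a Lipschitz continuous gradient. -/
theorem proxObj_proxMap_add_le (hQ : IsClosed Q) (hQc : Convex ℝ Q) (hd : IsProxFunction d μd A)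
    (hR : 0 < R) (hβ : 0 < β) (hz : z ∈ Q) (s p : E →L[ℝ] ℝ) :
    proxObj d z R β (s + p) (proxMap Q d z R β (s + p))
      ≤ proxObj d z R β s (proxMap Q d z R β s) + p (proxMap Q d z R β s - z)
        + R ^ 2 / (2 * β * μd) * ‖p‖ ^ 2 := by
  set x := proxMap Q d z R β s
  set x' := proxMap Q d z R β (s + p)
  have hx' : x' ∈ Q ∩ closedBall z R := (proxMap_spec hQ hd hR hz (s + p)).1
  have h1 := proxObj_add_le hQ hQc hd hR hβ hz s hx'
  have h2 : proxObj d z R β (s + p) x' = proxObj d z R β s x' + p (x - z) + p (x' - x) := by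
    have : p (x' - z) = p (x - z) + p (x' - x) := by rw [← map_add]; congr 1; abel
    simp only [proxObj, add_apply]
    linarith
  have h3 : p (x' - x) ≤ ‖p‖ * ‖x' - x‖ := (le_abs_self _).trans (p.le_opNorm _)
  have hμ := hd.pos
  -- Young's inequality, with weights chosen so that the quadratic decrease in `h1` absorbs the
  -- second term.
  have h4 : ‖p‖ * ‖x' - x‖ ≤ R ^ 2 / (2 * β * μd) * ‖p‖ ^ 2
      + 1 / 2 * (β * μd / R ^ 2) * ‖x' - x‖ ^ 2 := by
    have h5 : R ^ 2 / (2 * β * μd) * ‖p‖ ^ 2 + 1 / 2 * (β * μd / R ^ 2) * ‖x' - x‖ ^ 2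
        - ‖p‖ * ‖x' - x‖ = (R ^ 2 * ‖p‖ - β * μd * ‖x' - x‖) ^ 2 / (2 * β * μd * R ^ 2) := by
      field_simp
      ring
    have : 0 ≤ (R ^ 2 * ‖p‖ - β * μd * ‖x' - x‖) ^ 2 / (2 * β * μd * R ^ 2) := by positivity
    linarith
  linarith

/-- The prox-mapping depends continuously on the center and on the functional. -/
theorem continuous_proxMap (hQ : IsClosed Q) (hQc : Convex ℝ Q) (hd : IsProxFunction d μd A)
    (hR : 0 < R) (hβ : 0 < β) :
    Continuous fun p : Q × (E →L[ℝ] ℝ) => proxMap Q d p.1 R β p.2 := by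
  have := FiniteDimensional.proper ℝ E
  let B := closedBall (0 : E) 1
  have : CompactSpace B := isCompact_iff_compactSpace.1 (isCompact_closedBall _ _)
  have hmem : ∀ p : Q × (E →L[ℝ] ℝ), R⁻¹ • (proxMap Q d p.1 R β p.2 - p.1) ∈ B := fun p =>
    inv_smul_sub_mem_closedBall hR (proxMap_spec hQ hd hR p.1.2 p.2).1.2
  let V : Q × (E →L[ℝ] ℝ) → B := fun p => ⟨_, hmem p⟩
  have hdB : Continuous fun v : B => d v := continuousOn_iff_continuous_domRestrict.1 hd.continuousOn
  -- The feasible set moves with the center. In rescaled coordinates its points are exactly the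
  -- `truncDir R z y` with `y ∈ Q`, and for fixed `y` these vary continuously with `z`. Hence
  -- optimality is an intersection of closed conditions, and a map into the compact ball with closed
  -- graph is continuous.
  let Γ : Set ((Q × (E →L[ℝ] ℝ)) × B) := {q | (q.1.1 : E) + R • (q.2 : E) ∈ Q ∧ ∀ y ∈ Q,
    R * q.1.2 (truncDir R q.1.1 y) - β * d (truncDir R q.1.1 y)
      ≤ R * q.1.2 q.2 - β * d q.2}
  have hΓ : IsClosed Γ := by
    refine IsClosed.and (hQ.preimage (by fun_prop)) ?_
    simp only [Set.ofPred_forall]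
    refine isClosed_iInter fun y => isClosed_iInter fun hy => ?_
    have c1 : Continuous fun q : (Q × (E →L[ℝ] ℝ)) × B => truncDir R (q.1.1 : E) y :=
      (continuous_truncDir hR y).comp (by fun_prop)
    have c2 : Continuous fun q : (Q × (E →L[ℝ] ℝ)) × B => d (truncDir R (q.1.1 : E) y) :=
      hd.continuousOn.comp_continuous c1 fun q => truncDir_mem hR _ _
    have c3 : Continuous fun q : (Q × (E →L[ℝ] ℝ)) × B => d q.2 := hdB.comp continuous_snd
    have c4 : Continuous fun q : (Q × (E →L[ℝ] ℝ)) × B => q.1.2 (truncDir R (q.1.1 : E) y) :=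
      Continuous.clm_apply (by fun_prop) c1
    have c5 : Continuous fun q : (Q × (E →L[ℝ] ℝ)) × B => q.1.2 q.2 :=
      Continuous.clm_apply (by fun_prop) (by fun_prop)
    exact isClosed_le ((continuous_const.mul c4).sub (continuous_const.mul c2))
      ((continuous_const.mul c5).sub (continuous_const.mul c3))
  have hobj : ∀ (z : E) (s : E →L[ℝ] ℝ) (u : E),
      proxObj d z R β s (z + R • u) = R * s u - β * d u := by
    intro z s u
    simp [proxObj, smul_smul, inv_mul_cancel₀ hR.ne']
  have hgraph : ∀ q : (Q × (E →L[ℝ] ℝ)) × B, q ∈ Γ ↔ V q.1 = q.2 := by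
    rintro ⟨⟨⟨z, hz⟩, s⟩, ⟨v, hv⟩⟩
    have hball : ∀ u ∈ B, z + R • u ∈ closedBall z R := by
      intro u hu
      rw [mem_closedBall_zero_iff] at hu
      rw [mem_closedBall, dist_eq_norm, add_sub_cancel_left, norm_smul, Real.norm_of_nonneg hR.le]
      nlinarith
    simp only [Γ, V, Set.mem_ofPred_eq, Subtype.mk.injEq]
    constructor
    · rintro ⟨h1, h2⟩
      have := eq_proxMap hQ hQc hd hR hβ hz s (y := z + R • v) ⟨h1, hball v hv⟩ (fun y hy => by
        have := h2 y hy.1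
        rw [truncDir_eq hy.2, ← hobj z, ← hobj z, smul_smul, mul_inv_cancel₀ hR.ne', one_smul,
          add_sub_cancel] at this
        exact this)
      rw [← this, add_sub_cancel_left, smul_smul, inv_mul_cancel₀ hR.ne', one_smul]
    · intro h
      have hs := proxMap_spec (β := β) hQ hd hR hz s
      have e : z + R • v = proxMap Q d z R β s := by
        rw [← h, smul_smul, mul_inv_cancel₀ hR.ne', one_smul, add_sub_cancel]
      refine ⟨e ▸ hs.1.1, fun y hy => ?_⟩
      rw [← hobj z, ← hobj z, e]
      exact hs.2 ⟨add_smul_truncDir_mem hQc hR hz hy, hball _ (truncDir_mem hR _ _)⟩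
  have hV : Continuous V := by
    refine continuous_iff_isClosed.2 fun F hF => ?_
    have : V ⁻¹' F = Prod.fst '' (Γ ∩ Prod.snd ⁻¹' F) := by
      ext p
      constructor
      · exact fun hp => ⟨(p, V p), ⟨(hgraph _).2 rfl, hp⟩, rfl⟩
      · rintro ⟨q, ⟨hq, hqF⟩, rfl⟩
        have := (hgraph q).1 hq
        simpa [this] using hqF
    rw [this]
    exact isClosedMap_fst_of_compactSpace _ (hΓ.inter (hF.preimage continuous_snd))
  have heq : (fun p : Q × (E →L[ℝ] ℝ) => proxMap Q d p.1 R β p.2)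
      = fun p => (p.1 : E) + R • (V p : E) := by
    ext p
    simp [V, smul_smul, mul_inv_cancel₀ hR.ne']
  rw [heq]
  fun_prop

end FiniteDim

end Prox

/-! ### Regret of dual averaging and the accuracy of one stage, pathwise. -/

section DualAveraging

variable {E : Type*} [NormedAddCommGroup E] [NormedSpace ℝ E]
  {Q : Set E} {d : E → ℝ} {μd A R β : ℝ} {z : E}

theorem dualAveraging_fst (q : ℕ → E → (E →L[ℝ] ℝ)) (n : ℕ) :
    (dualAveraging Q d z R β q n).1
      = ∑ i ∈ Finset.range n, q i (dualAveraging Q d z R β q i).2 := by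
  induction n with
  | zero => rfl
  | succ n ih => rw [Finset.sum_range_succ, ← ih]; rfl

variable [FiniteDimensional ℝ E]

theorem dualAveraging_snd (hQ : IsClosed Q) (hQc : Convex ℝ Q) (hd : IsProxFunction d μd A)
    (hR : 0 < R) (hβ : 0 < β) (hz : z ∈ Q) (q : ℕ → E → (E →L[ℝ] ℝ)) (n : ℕ) :
    (dualAveraging Q d z R β q n).2
      = proxMap Q d z R β (-(dualAveraging Q d z R β q n).1) := by
  cases n with
  | zero => simpa [dualAveraging] using (proxMap_zero hQ hQc hd hR hβ hz).symm
  | succ n => rfl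

theorem dualAveraging_snd_mem (hQ : IsClosed Q) (hQc : Convex ℝ Q) (hd : IsProxFunction d μd A)
    (hR : 0 < R) (hβ : 0 < β) (hz : z ∈ Q) (q : ℕ → E → (E →L[ℝ] ℝ)) (n : ℕ) :
    (dualAveraging Q d z R β q n).2 ∈ Q ∩ closedBall z R := by
  rw [dualAveraging_snd hQ hQc hd hR hβ hz]
  exact (proxMap_spec hQ hd hR hz _).1

/-- Regret of dual averaging; the answers of the oracle are split into two parts, and the second
one is paired with prox-points that do not depend on it. -/
theorem sum_dualAveraging_le (hQ : IsClosed Q) (hQc : Convex ℝ Q) (hd : IsProxFunction d μd A)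
    (hR : 0 < R) (hβ : 0 < β) (hz : z ∈ Q) (q : ℕ → E → (E →L[ℝ] ℝ)) (a b : ℕ → E →L[ℝ] ℝ)
    (n : ℕ) (hab : ∀ i < n, q i (dualAveraging Q d z R β q i).2 = a i + b i)
    {x : E} (hx : x ∈ Q ∩ closedBall z R) :
    ∑ i ∈ Finset.range n, a i ((dualAveraging Q d z R β q i).2 - x)
      ≤ β * d (R⁻¹ • (x - z))
        + R ^ 2 / (2 * β * μd) * ∑ i ∈ Finset.range n, (‖a i‖ ^ 2 + ‖b i‖ ^ 2)
        - ∑ i ∈ Finset.range n,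
          b i (proxMap Q d z R β (-(dualAveraging Q d z R β q i).1 - a i) - x) := by
  set p := dualAveraging Q d z R β q with hp
  set c := R ^ 2 / (2 * β * μd) with hc
  -- The potential is the maximal value of the prox-objective at `-s_k`. Adding `-a k` and then `-b
  -- k` costs the two squared norms separately, and the intermediate prox-point depends on `s_k` and
  -- `a k` only.
  have hV : ∀ k ≤ n, proxObj d z R β (-(p k).1) (p k).2
      ≤ c * ∑ i ∈ Finset.range k, (‖a i‖ ^ 2 + ‖b i‖ ^ 2)
        - ∑ i ∈ Finset.range k, a i ((p i).2 - z)
        - ∑ i ∈ Finset.range k, b i (proxMap Q d z R β (-(p i).1 - a i) - z) := by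
    intro k
    induction k with
    | zero => simp [hp, dualAveraging, proxObj, hd.zero]
    | succ k ih =>
      intro hk
      have ih := ih (by omega)
      have e : -(p (k + 1)).1 = -(p k).1 - a k - b k := by
        have : (p (k + 1)).1 = (p k).1 + q k (p k).2 := rfl
        rw [this, hab k (by omega)]; abel
      have h1 := proxObj_proxMap_add_le hQ hQc hd hR hβ hz (-(p k).1) (-a k)
      have h2 := proxObj_proxMap_add_le hQ hQc hd hR hβ hz (-(p k).1 - a k) (-b k)
      rw [← dualAveraging_snd hQ hQc hd hR hβ hz q k, ← sub_eq_add_neg] at h1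
      rw [← sub_eq_add_neg, ← e, ← dualAveraging_snd hQ hQc hd hR hβ hz q (k + 1)] at h2
      simp only [neg_apply, norm_neg, ← hc, ← hp] at h1 h2
      simp only [Finset.sum_range_succ, mul_add] at ih ⊢
      linarith
  have h1 := hV n le_rfl
  have h2 : proxObj d z R β (-(p n).1) x ≤ proxObj d z R β (-(p n).1) (p n).2 := by
    rw [hp, dualAveraging_snd hQ hQc hd hR hβ hz q n]
    exact (proxMap_spec hQ hd hR hz _).2 hx
  have h3 : (p n).1 (x - z) = ∑ i ∈ Finset.range n, a i (x - z)
      + ∑ i ∈ Finset.range n, b i (x - z) := by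
    rw [hp, dualAveraging_fst, ← Finset.sum_add_distrib, sum_apply]
    refine Finset.sum_congr rfl fun i hi => ?_
    rw [hab i (Finset.mem_range.1 hi), add_apply]
  have h4 : ∀ (u : ℕ → E →L[ℝ] ℝ) (v : ℕ → E), ∑ i ∈ Finset.range n, u i (v i - x)
      = ∑ i ∈ Finset.range n, u i (v i - z) - ∑ i ∈ Finset.range n, u i (x - z) := by
    intro u v
    rw [← Finset.sum_sub_distrib]
    refine Finset.sum_congr rfl fun i _ => ?_
    rw [← map_sub]; congr 1; abel
  rw [h4, h4]
  simp only [proxObj, neg_apply] at h2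
  simp only [proxObj, neg_apply] at h1
  linarith

theorem dualAveragingOutput_mem (hQ : IsClosed Q) (hQc : Convex ℝ Q) (hd : IsProxFunction d μd A)
    {γ : ℝ} (hR : 0 < R) (hγ : 0 < γ) (hz : z ∈ Q) (n : ℕ) (q : ℕ → E → (E →L[ℝ] ℝ)) :
    dualAveragingOutput Q d z R γ n q ∈ Q ∩ closedBall z R := by
  rw [dualAveragingOutput, Finset.smul_sum]
  refine (hQc.inter (convex_closedBall z R)).sum_mem (fun _ _ => by positivity) ?_
    fun i _ => dualAveraging_snd_mem hQ hQc hd hR (by positivity) hz q i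
  simp
  field_simp

theorem dualAveragingOutput_sub_le {f : E → ℝ} (hf : ConvexOn ℝ Q f) (hQ : IsClosed Q)
    (hd : IsProxFunction d μd A) {γ : ℝ} (hR : 0 < R) (hγ : 0 < γ) (hz : z ∈ Q) (n : ℕ)
    (q : ℕ → E → (E →L[ℝ] ℝ)) (x : E) :
    ((n : ℝ) + 1) * (f (dualAveragingOutput Q d z R γ n q) - f x)
      ≤ ∑ i ∈ Finset.range (n + 1),
        (f (dualAveraging Q d z R (γ * √((n : ℝ) + 1)) q i).2 - f x) := by
  have h := hf.map_sum_le (t := Finset.range (n + 1)) (w := fun _ => ((n : ℝ) + 1)⁻¹)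
    (p := fun i => (dualAveraging Q d z R (γ * √((n : ℝ) + 1)) q i).2)
    (fun _ _ => by positivity) (by simp; field_simp)
    (fun i _ => (dualAveraging_snd_mem hQ hf.1 hd hR (by positivity) hz q i).1)
  rw [dualAveragingOutput, Finset.smul_sum]
  rw [Finset.sum_sub_distrib, Finset.sum_const, Finset.card_range, nsmul_eq_mul]
  have hn : (0 : ℝ) < n + 1 := by positivity
  simp only [smul_eq_mul, ← Finset.mul_sum] at h
  have := mul_le_mul_of_nonneg_left h hn.le
  rw [mul_inv_cancel_left₀ hn.ne'] at this
  push_cast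
  rw [mul_sub]
  linarith

/-- Accuracy of one run of dual averaging with a noisy oracle. -/
theorem dualAveragingOutput_sub_le_noise {f : E → ℝ} (hf : ConvexOn ℝ Q f) (hQ : IsClosed Q)
    (hd : IsProxFunction d μd A) (hA : 0 < A) {L σ : ℝ} (hσ : 0 < σ)
    (hR : 0 < R) (hz : z ∈ Q) {γ : ℝ} (hγ : γ = R * √((L ^ 2 + σ ^ 2) / (2 * μd * A)))
    (n : ℕ) (q : ℕ → E → (E →L[ℝ] ℝ)) (a b : ℕ → E →L[ℝ] ℝ)
    (hab : ∀ i < n + 1, q i (dualAveraging Q d z R (γ * √((n : ℝ) + 1)) q i).2 = a i + b i)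
    (ha : ∀ i < n + 1, a i ∈ boundedSubdifferential Q f L
      (dualAveraging Q d z R (γ * √((n : ℝ) + 1)) q i).2)
    {x : E} (hx : x ∈ Q ∩ closedBall z R) :
    ((n : ℝ) + 1) * (f (dualAveragingOutput Q d z R γ n q) - f x)
      ≤ 2 * R * √((n : ℝ) + 1) * √((L ^ 2 + σ ^ 2) * A / (2 * μd))
        + R * σ * ∑ i ∈ Finset.range (n + 1),
          (σ * √(A / (2 * μd)) / (√(L ^ 2 + σ ^ 2) * √((n : ℝ) + 1)) * (‖b i‖ ^ 2 / σ ^ 2 - 1)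
            + -(b i (proxMap Q d z R (γ * √((n : ℝ) + 1))
              (-(dualAveraging Q d z R (γ * √((n : ℝ) + 1)) q i).1 - a i) - x)) / (R * σ)) := by
  have hμ := hd.pos
  have hγ0 : 0 < γ := by rw [hγ]; positivity
  set β := γ * √((n : ℝ) + 1) with hβ
  have hβ0 : 0 < β := by positivity
  have h1 := dualAveragingOutput_sub_le hf hQ hd hR hγ0 hz n q x
  have h2 := sum_dualAveraging_le hQ hf.1 hd hR hβ0 hz q a b (n + 1) hab hx
  have h3 : ∑ i ∈ Finset.range (n + 1), (f (dualAveraging Q d z R β q i).2 - f x)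
      ≤ ∑ i ∈ Finset.range (n + 1), a i ((dualAveraging Q d z R β q i).2 - x) := by
    refine Finset.sum_le_sum fun i hi => ?_
    have := (ha i (Finset.mem_range.1 hi)).2 x hx.1
    have e : a i (x - (dualAveraging Q d z R β q i).2)
        = -a i ((dualAveraging Q d z R β q i).2 - x) := by rw [← map_neg, neg_sub]
    linarith
  have h4 : d (R⁻¹ • (x - z)) ≤ A := hd.le _ (inv_smul_sub_mem_closedBall hR hx.2)
  set D := √(L ^ 2 + σ ^ 2) with hD
  set κ := √(A / (2 * μd)) with hκ
  set r := √((n : ℝ) + 1) with hr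
  have hD0 : 0 < D := Real.sqrt_pos.2 (by positivity)
  have hκ0 : 0 < κ := Real.sqrt_pos.2 (by positivity)
  have hr0 : 0 < r := Real.sqrt_pos.2 (by positivity)
  have hD2 : D ^ 2 = L ^ 2 + σ ^ 2 := Real.sq_sqrt (by positivity)
  have hr2 : r ^ 2 = (n : ℝ) + 1 := Real.sq_sqrt (by positivity)
  have hκ2 : κ ^ 2 = A / (2 * μd) := Real.sq_sqrt (by positivity)
  have e1 : √((L ^ 2 + σ ^ 2) * A / (2 * μd)) = D * κ := by
    rw [mul_div_assoc, Real.sqrt_mul (by positivity)]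
  -- This `β` balances the two regret terms: `β * A` and the quadratic term with `L² + σ²` in place
  -- of the squared norms both equal `R * r * D * κ`.
  have hβA : β = R * r * D * κ / A := by
    have : √((L ^ 2 + σ ^ 2) / (2 * μd * A)) = D * κ / A := by
      rw [Real.sqrt_eq_iff_mul_self_eq (by positivity) (by positivity)]
      have : D * κ / A * (D * κ / A) = D ^ 2 * κ ^ 2 / A ^ 2 := by ring
      rw [this, hD2, hκ2]; field_simp
    rw [hβ, hγ, this]; ring
  have hc : R ^ 2 / (2 * β * μd) = R * κ / (D * r) := by
    have : A = κ ^ 2 * (2 * μd) := by rw [hκ2]; field_simp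
    rw [hβA, this]
    field_simp
  have h5 : β * d (R⁻¹ • (x - z)) ≤ R * r * D * κ := by
    calc _ ≤ β * A := mul_le_mul_of_nonneg_left h4 hβ0.le
      _ = _ := by rw [hβA]; field_simp
  have h6 : R ^ 2 / (2 * β * μd) * ∑ i ∈ Finset.range (n + 1), (‖a i‖ ^ 2 + ‖b i‖ ^ 2)
      ≤ R * r * D * κ + R * κ / (D * r) * ∑ i ∈ Finset.range (n + 1), (‖b i‖ ^ 2 - σ ^ 2) := by
    rw [hc]
    -- The level `σ²` of each squared noise norm joins `L²` in the deterministic part; only the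
    -- excess over it is left to the Chernoff bound.
    have h7 : ∑ i ∈ Finset.range (n + 1), (‖a i‖ ^ 2 + ‖b i‖ ^ 2)
        ≤ r ^ 2 * D ^ 2 + ∑ i ∈ Finset.range (n + 1), (‖b i‖ ^ 2 - σ ^ 2) := by
      have : r ^ 2 * D ^ 2 = ∑ i ∈ Finset.range (n + 1), (L ^ 2 + σ ^ 2) := by
        rw [hr2, hD2]; simp [mul_add]
      rw [this, ← Finset.sum_add_distrib]
      refine Finset.sum_le_sum fun i hi => ?_
      have := pow_le_pow_left₀ (norm_nonneg _) (ha i (Finset.mem_range.1 hi)).1 2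
      linarith
    refine (mul_le_mul_of_nonneg_left h7 (by positivity)).trans (le_of_eq ?_)
    rw [mul_add]
    congr 1
    field_simp
  have e2 : R * σ * ∑ i ∈ Finset.range (n + 1),
      (σ * κ / (D * r) * (‖b i‖ ^ 2 / σ ^ 2 - 1)
        + -(b i (proxMap Q d z R β (-(dualAveraging Q d z R β q i).1 - a i) - x)) / (R * σ))
      = R * κ / (D * r) * ∑ i ∈ Finset.range (n + 1), (‖b i‖ ^ 2 - σ ^ 2)
        - ∑ i ∈ Finset.range (n + 1),
          b i (proxMap Q d z R β (-(dualAveraging Q d z R β q i).1 - a i) - x) := by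
    rw [Finset.mul_sum, Finset.mul_sum, ← Finset.sum_sub_distrib]
    refine Finset.sum_congr rfl fun i _ => ?_
    field_simp
    ring
  rw [e1, e2]
  linarith

end DualAveraging

/-! ### Conditional expectations and the Chernoff bound for adapted sums. -/

section Chernoff

variable {Ω : Type*} {m m0 : MeasurableSpace Ω} {P : Measure Ω}

/-- On the smaller σ-algebra the measure with density `g` is dominated by `C` times `P`. Comparing
measures in this way avoids any integrability requirement on `f`. -/
theorem lintegral_mul_ofReal_le_of_condExp_le [IsFiniteMeasure P]
    (hm : m ≤ m0) {f : Ω → ENNReal} (hf : Measurable[m] f) {g : Ω → ℝ} (hg : Integrable g P)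
    (hg0 : 0 ≤ᵐ[P] g) {C : ℝ} (hC : ∀ᵐ w ∂P, (P[g | m]) w ≤ C) :
    ∫⁻ w, f w * ENNReal.ofReal (g w) ∂P ≤ ENNReal.ofReal C * ∫⁻ w, f w ∂P := by
  have hle : (P.withDensity fun w => ENNReal.ofReal (g w)).trim hm
      ≤ ENNReal.ofReal C • P.trim hm := by
    refine Measure.le_iff.2 fun s hs => ?_
    rw [Measure.smul_apply, trim_measurableSet_eq hm hs, trim_measurableSet_eq hm hs,
      withDensity_apply _ (hm _ hs), ← ofReal_integral_eq_lintegral_ofReal hg.integrableOn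
        (ae_restrict_of_ae hg0), ← setIntegral_condExp hm hg hs, smul_eq_mul]
    have h1 : ∫ w in s, (P[g | m]) w ∂P ≤ ∫ _ in s, C ∂P :=
      integral_mono_ae integrable_condExp.integrableOn (integrable_const C)
        (ae_restrict_of_ae hC)
    rw [setIntegral_const, smul_eq_mul] at h1
    refine (ENNReal.ofReal_le_ofReal h1).trans ?_
    rw [ENNReal.ofReal_mul measureReal_nonneg, ofReal_measureReal, mul_comm]
  have hae : AEMeasurable (fun w => ENNReal.ofReal (g w)) P := hg.aemeasurable.ennreal_ofReal
  have h1 : ∫⁻ w, f w * ENNReal.ofReal (g w) ∂P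
      = ∫⁻ w, f w ∂(P.withDensity fun w => ENNReal.ofReal (g w)) := by
    rw [lintegral_withDensity_eq_lintegral_mul₀ hae (hf.mono hm le_rfl).aemeasurable]
    simp [mul_comm]
  rw [h1, ← lintegral_trim hm hf, ← lintegral_trim hm hf (μ := P), ← smul_eq_mul,
    ← lintegral_smul_measure]
  exact lintegral_mono' hle le_rfl

/-- Chernoff bound for a sum of adapted random variables. -/
theorem measure_sum_ge_le [IsProbabilityMeasure P] (ℱ : Filtration ℕ m0) (t n : ℕ)
    (W g : ℕ → Ω → ℝ) {l C T : ℝ} (hl : 0 < l) (hC : 0 ≤ C)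
    (hW : ∀ i < n, Measurable[ℱ (t + i + 1)] (W i))
    (hg : ∀ i < n, Integrable (g i) P)
    (hWg : ∀ i < n, ∀ w, Real.exp (l * W i w) ≤ g i w)
    (hgC : ∀ i < n, ∀ᵐ w ∂P, (P[g i | ℱ (t + i)]) w ≤ C) :
    P {w | T ≤ ∑ i ∈ Finset.range n, W i w} ≤ ENNReal.ofReal (C ^ n * Real.exp (-(l * T))) := by
  have hmeas : ∀ k ≤ n, Measurable[ℱ (t + k)] fun w => ∑ i ∈ Finset.range k, W i w := by
    intro k hk
    refine Finset.measurable_sum _ fun i hi => ?_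
    have hi := Finset.mem_range.1 hi
    exact (hW i (by omega)).mono (ℱ.mono (by omega)) le_rfl
  have hexp : ∀ k ≤ n, Measurable[ℱ (t + k)]
      fun w => ENNReal.ofReal (Real.exp (l * ∑ i ∈ Finset.range k, W i w)) := fun k hk =>
    (Real.measurable_exp.comp ((hmeas k hk).const_mul l)).ennreal_ofReal
  have hind : ∀ k ≤ n, ∫⁻ w, ENNReal.ofReal (Real.exp (l * ∑ i ∈ Finset.range k, W i w)) ∂P
      ≤ ENNReal.ofReal C ^ k := by
    intro k
    induction k with
    | zero => simp
    | succ k ih =>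
      intro hk
      have ih := ih (by omega)
      have hk' : k < n := by omega
      calc _ ≤ ∫⁻ w, ENNReal.ofReal (Real.exp (l * ∑ i ∈ Finset.range k, W i w))
              * ENNReal.ofReal (g k w) ∂P := by
            refine lintegral_mono fun w => ?_
            rw [Finset.sum_range_succ, mul_add, Real.exp_add,
              ENNReal.ofReal_mul (Real.exp_pos _).le]
            gcongr
            exact hWg k hk' w
        _ ≤ ENNReal.ofReal C * ENNReal.ofReal C ^ k :=
            (lintegral_mul_ofReal_le_of_condExp_le (ℱ.le _) (hexp k hk'.le) (hg k hk')
              (Filter.Eventually.of_forall fun w => (Real.exp_pos _).le.trans (hWg k hk' w))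
              (hgC k hk')).trans (mul_le_mul_right ih _)
        _ = _ := (pow_succ' _ _).symm
  have hae : AEMeasurable
      (fun w => ENNReal.ofReal (Real.exp (l * ∑ i ∈ Finset.range n, W i w))) P :=
    ((hexp n le_rfl).mono (ℱ.le _) le_rfl).aemeasurable
  have hsub : {w | T ≤ ∑ i ∈ Finset.range n, W i w} ⊆ {w | ENNReal.ofReal (Real.exp (l * T))
      ≤ ENNReal.ofReal (Real.exp (l * ∑ i ∈ Finset.range n, W i w))} := fun w hw =>
    ENNReal.ofReal_le_ofReal (Real.exp_le_exp.2 (mul_le_mul_of_nonneg_left hw hl.le))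
  calc _ ≤ _ := measure_mono hsub
    _ ≤ _ := meas_ge_le_lintegral_div hae (by simp [Real.exp_pos]) ENNReal.ofReal_ne_top
    _ ≤ ENNReal.ofReal C ^ n / ENNReal.ofReal (Real.exp (l * T)) :=
        ENNReal.div_le_div_right (hind n le_rfl) _
    _ = _ := by
        rw [Real.exp_neg, ← div_eq_mul_inv, ENNReal.ofReal_div_of_pos (Real.exp_pos _),
          ENNReal.ofReal_pow hC]

/-- A centered functional has mean zero on bounded vectors known in advance. -/
theorem condExp_sub_condExp_apply {E : Type*} [NormedAddCommGroup E] [NormedSpace ℝ E]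
    [FiniteDimensional ℝ E] [IsProbabilityMeasure P] (hm : m ≤ m0)
    {g : Ω → (E →L[ℝ] ℝ)} (hg : Integrable g P) {u : Ω → E} (hu : StronglyMeasurable[m] u)
    {K : ℝ} (hK : ∀ w, ‖u w‖ ≤ K) :
    Integrable (fun w => (g w - (P[g | m]) w) (u w)) P ∧
      P[fun w => (g w - (P[g | m]) w) (u w) | m] =ᵐ[P] 0 := by
  have hξ : Integrable (g - P[g | m]) P := hg.sub integrable_condExp
  have hmeas : AEStronglyMeasurable (fun w => (g w - (P[g | m]) w) (u w)) P :=
    (ContinuousLinearMap.id ℝ (E →L[ℝ] ℝ)).aestronglyMeasurable_comp₂ hξ.aestronglyMeasurable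
      (hu.mono hm).aestronglyMeasurable
  have hint : Integrable (fun w => (g w - (P[g | m]) w) (u w)) P := by
    refine (hξ.norm.mul_const K).mono' hmeas (Filter.Eventually.of_forall fun w => ?_)
    exact ((g w - (P[g | m]) w).le_opNorm (u w)).trans
      (mul_le_mul_of_nonneg_left (hK w) (norm_nonneg _))
  refine ⟨hint, ?_⟩
  have h1 := condExp_bilin_of_stronglyMeasurable_right (m := m)
    (ContinuousLinearMap.id ℝ (E →L[ℝ] ℝ)) (f := g - P[g | m]) (g := u) hu hint hξ
  have h2 : P[g - P[g | m] | m] =ᵐ[P] 0 := by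
    refine (condExp_sub hg integrable_condExp m).trans ?_
    rw [condExp_of_stronglyMeasurable hm stronglyMeasurable_condExp integrable_condExp]
    simp
  refine h1.trans ?_
  filter_upwards [h2] with w hw
  simp [hw]

end Chernoff

theorem stronglyMeasurable_proxMap {E : Type*} [NormedAddCommGroup E] [NormedSpace ℝ E]
    [FiniteDimensional ℝ E] {Ω : Type*} {m : MeasurableSpace Ω} {Q : Set E} {d : E → ℝ}
    {μd A R β : ℝ} (hQ : IsClosed Q) (hQc : Convex ℝ Q) (hd : IsProxFunction d μd A)
    (hR : 0 < R) (hβ : 0 < β) {z : Ω → E} (hz : StronglyMeasurable z) (hzQ : ∀ w, z w ∈ Q)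
    {s : Ω → (E →L[ℝ] ℝ)} (hs : StronglyMeasurable s) :
    StronglyMeasurable fun w => proxMap Q d (z w) R β (s w) := by
  borelize E
  have := FiniteDimensional.proper ℝ E
  have h1 : StronglyMeasurable fun w => (⟨z w, hzQ w⟩ : Q) :=
    (hz.measurable.subtype_mk (h := hzQ)).stronglyMeasurable
  exact (continuous_proxMap hQ hQc hd hR hβ).comp_stronglyMeasurable (h1.prodMk hs)

/-! ### Measurability along the run and the failure probability of a stage. -/

namespace AdaptiveScheme

variable {E : Type*} [NormedAddCommGroup E] [NormedSpace ℝ E] {S : AdaptiveScheme E}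

/-- The step size parameter `β` of the stage that is run with radius `R_k`. -/
def β (S : AdaptiveScheme E) (k : ℕ) : ℝ := S.γ k * √((S.N₀ : ℝ) + 1)

/-- The pairs `(s_i, x_i)` of the stage that is run with radius `R_k`. -/
def run (S : AdaptiveScheme E) (q : ℕ → E → (E →L[ℝ] ℝ)) (k i : ℕ) : (E →L[ℝ] ℝ) × E :=
  dualAveraging S.Q S.d (S.y q k) (S.R k) (S.β k) (fun j => q (k * (S.N₀ + 1) + j)) i

theorem R_pos {E : Type*} {S : AdaptiveScheme E} (hR : 0 < S.R₀) (k : ℕ) : 0 < S.R k := by unfold R; positivity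

theorem γ_pos {E : Type*} {S : AdaptiveScheme E} (hμ : 0 < S.μd) (hA : 0 < S.A)
    (hσ : 0 < S.σ) (hR : 0 < S.R₀) (k : ℕ) :
    0 < S.γ k := by
  have := S.R_pos hR k
  unfold γ; positivity

theorem β_pos {E : Type*} {S : AdaptiveScheme E} (hμ : 0 < S.μd) (hA : 0 < S.A)
    (hσ : 0 < S.σ) (hR : 0 < S.R₀) (k : ℕ) :
    0 < S.β k := by
  have := S.γ_pos hμ hA hσ hR k
  unfold β; positivity

theorem searchPoint_eq_run (q : ℕ → E → (E →L[ℝ] ℝ)) (k : ℕ) {i : ℕ} (hi : i < S.N₀ + 1) :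
    S.searchPoint q (k * (S.N₀ + 1) + i) = (S.run q k i).2 := by
  have h1 : (k * (S.N₀ + 1) + i) / (S.N₀ + 1) = k := by
    rw [mul_comm, Nat.mul_add_div (Nat.succ_pos _), Nat.div_eq_of_lt hi, add_zero]
  have h2 : (k * (S.N₀ + 1) + i) % (S.N₀ + 1) = i := by
    rw [mul_comm, Nat.mul_add_mod, Nat.mod_eq_of_lt hi]
  simp only [searchPoint, h1, h2]
  rfl

theorem run_succ_fst (q : ℕ → E → (E →L[ℝ] ℝ)) (k i : ℕ) :
    (S.run q k (i + 1)).1 = (S.run q k i).1 + q (k * (S.N₀ + 1) + i) (S.run q k i).2 := rfl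

variable [FiniteDimensional ℝ E]

theorem run_snd_eq (hQ : IsClosed S.Q) (hQc : Convex ℝ S.Q) (hd : IsProxFunction S.d S.μd S.A)
    (hA : 0 < S.A) (hσ : 0 < S.σ) (hR : 0 < S.R₀) {q : ℕ → E → (E →L[ℝ] ℝ)} {k : ℕ}
    (hy : S.y q k ∈ S.Q) (i : ℕ) :
    (S.run q k i).2 = proxMap S.Q S.d (S.y q k) (S.R k) (S.β k) (-(S.run q k i).1) :=
  dualAveraging_snd hQ hQc hd (S.R_pos hR k) (S.β_pos hd.pos hA hσ hR k) hy _ i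

theorem y_succ_mem (hQ : IsClosed S.Q) (hQc : Convex ℝ S.Q) (hd : IsProxFunction S.d S.μd S.A)
    (hA : 0 < S.A) (hσ : 0 < S.σ) (hR : 0 < S.R₀) {q : ℕ → E → (E →L[ℝ] ℝ)} {k : ℕ}
    (hy : S.y q k ∈ S.Q) : S.y q (k + 1) ∈ S.Q ∩ closedBall (S.y q k) (S.R k) :=
  dualAveragingOutput_mem hQ hQc hd (S.R_pos hR k) (S.γ_pos hd.pos hA hσ hR k) hy _ _

theorem y_mem (hQ : IsClosed S.Q) (hQc : Convex ℝ S.Q) (hd : IsProxFunction S.d S.μd S.A)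
    (hA : 0 < S.A) (hσ : 0 < S.σ) (hR : 0 < S.R₀) (hx₀ : S.x₀ ∈ S.Q)
    (q : ℕ → E → (E →L[ℝ] ℝ)) (k : ℕ) : S.y q k ∈ S.Q := by
  induction k with
  | zero => exact hx₀
  | succ k ih => exact (y_succ_mem hQ hQc hd hA hσ hR ih).1

variable {Ω Z : Type*} {m0 : MeasurableSpace Ω} [MeasurableSpace Z] [MeasurableSpace E]
  [BorelSpace E]

/-- Continuity of the prox-mapping carries measurability from `s_i` to `x_i`, and the oracle carries
it on to `s_{i+1}`. The σ-algebra at `k * (S.N₀ + 1) + i` is what is known just before call `i` of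
the stage. -/
theorem stronglyMeasurable_run (hQ : IsClosed S.Q) (hQc : Convex ℝ S.Q)
    (hd : IsProxFunction S.d S.μd S.A) (hA : 0 < S.A) (hσ : 0 < S.σ) (hR : 0 < S.R₀)
    (hx₀ : S.x₀ ∈ S.Q) {ℱ : Filtration ℕ m0} {G : E → Z → (E →L[ℝ] ℝ)} {ζ : ℕ → Ω → Z}
    (hG : StronglyMeasurable (Function.uncurry G)) (hζ : ∀ t, Measurable[ℱ (t + 1)] (ζ t)) {k : ℕ}
    (hy : StronglyMeasurable[ℱ (k * (S.N₀ + 1))] fun w => S.y (fun t x => G x (ζ t w)) k)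
    (i : ℕ) :
    StronglyMeasurable[ℱ (k * (S.N₀ + 1) + i)]
        (fun w => (S.run (fun t x => G x (ζ t w)) k i).1) ∧
      StronglyMeasurable[ℱ (k * (S.N₀ + 1) + i)]
        (fun w => (S.run (fun t x => G x (ζ t w)) k i).2) := by
  have hsnd : ∀ i, StronglyMeasurable[ℱ (k * (S.N₀ + 1) + i)]
        (fun w => (S.run (fun t x => G x (ζ t w)) k i).1) →
      StronglyMeasurable[ℱ (k * (S.N₀ + 1) + i)]
        (fun w => (S.run (fun t x => G x (ζ t w)) k i).2) := by
    intro i h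
    have hyQ : ∀ w, S.y (fun t x => G x (ζ t w)) k ∈ S.Q := fun w =>
      y_mem hQ hQc hd hA hσ hR hx₀ _ k
    simp_rw [fun w => run_snd_eq hQ hQc hd hA hσ hR (hyQ w) i]
    exact stronglyMeasurable_proxMap hQ hQc hd (S.R_pos hR k) (S.β_pos hd.pos hA hσ hR k)
      (hy.mono (ℱ.mono (by omega))) hyQ h.neg
  have hfst : StronglyMeasurable[ℱ (k * (S.N₀ + 1) + i)]
      (fun w => (S.run (fun t x => G x (ζ t w)) k i).1) := by
    induction i with
    | zero => exact stronglyMeasurable_const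
    | succ i ih =>
      simp_rw [run_succ_fst]
      refine (ih.mono (ℱ.mono (by omega))).add ?_
      exact hG.comp_measurable
        (((hsnd i ih).measurable.mono (ℱ.mono (by omega)) le_rfl).prodMk (hζ _))
  exact ⟨hfst, hsnd i hfst⟩

theorem stronglyMeasurable_y (hQ : IsClosed S.Q) (hQc : Convex ℝ S.Q)
    (hd : IsProxFunction S.d S.μd S.A) (hA : 0 < S.A) (hσ : 0 < S.σ) (hR : 0 < S.R₀)
    (hx₀ : S.x₀ ∈ S.Q) {ℱ : Filtration ℕ m0} {G : E → Z → (E →L[ℝ] ℝ)} {ζ : ℕ → Ω → Z}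
    (hG : StronglyMeasurable (Function.uncurry G)) (hζ : ∀ t, Measurable[ℱ (t + 1)] (ζ t))
    (k : ℕ) :
    StronglyMeasurable[ℱ (k * (S.N₀ + 1))] fun w => S.y (fun t x => G x (ζ t w)) k := by
  induction k with
  | zero => exact stronglyMeasurable_const
  | succ k ih =>
    have hs : StronglyMeasurable[ℱ ((k + 1) * (S.N₀ + 1))] fun w =>
        ∑ i ∈ Finset.range (S.N₀ + 1), (S.run (fun t x => G x (ζ t w)) k i).2 := by
      refine Finset.stronglyMeasurable_fun_sum _ fun i hi => ?_
      have hi := Finset.mem_range.1 hi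
      exact (stronglyMeasurable_run hQ hQc hd hA hσ hR hx₀ hG hζ ih i).2.mono
        (ℱ.mono (by rw [add_mul]; omega))
    exact hs.const_smul _

/-- The accuracy of one stage, against a comparator known before the stage. -/
theorem measure_stage_fail_le {P : Measure Ω} [IsProbabilityMeasure P] {ℱ : Filtration ℕ m0}
    (hQ : IsClosed S.Q) (hd : IsProxFunction S.d S.μd S.A)
    (hA : 0 < S.A) (hσ : 0 < S.σ) (hR : 0 < S.R₀) (hx₀ : S.x₀ ∈ S.Q) {f : E → ℝ}
    (hf : ConvexOn ℝ S.Q f) (hL : ∀ x ∈ S.Q, (boundedSubdifferential S.Q f S.L x).Nonempty)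
    {G : E → Z → (E →L[ℝ] ℝ)} {ζ : ℕ → Ω → Z} (hG : S.IsOracle f P ℱ G ζ)
    (hAN : S.A / (2 * S.μd) ≤ ((S.N₀ : ℝ) + 1) / 64) {α : ℝ}
    (hα : 0 < Real.log (Real.logb 2 S.N / (2 * α))) {k : ℕ} (hk : k < S.m) {c : Ω → E}
    (hc : StronglyMeasurable[ℱ (k * (S.N₀ + 1))] c)
    (hcmem : ∀ w, c w ∈ S.Q ∩ closedBall (S.y (fun t x => G x (ζ t w)) k) (S.R k)) :
    P {w | S.R k * S.stageAccuracy α < f (S.y (fun t x => G x (ζ t w)) (k + 1)) - f (c w)}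
      ≤ ENNReal.ofReal (Real.exp (-Real.log (Real.logb 2 S.N / (2 * α)))) := by
  have hQc := hf.1
  have hμ := hd.pos
  have hRk := S.R_pos hR k
  have hβk := S.β_pos hμ hA hσ hR k
  set ℓ := Real.log (Real.logb 2 S.N / (2 * α)) with hℓ
  set t := k * (S.N₀ + 1) with ht
  set r := √((S.N₀ : ℝ) + 1) with hr
  set D := √(S.L ^ 2 + S.σ ^ 2) with hD
  have hr0 : 0 < r := Real.sqrt_pos.2 (by positivity)
  have hr2 : r ^ 2 = (S.N₀ : ℝ) + 1 := Real.sq_sqrt (by positivity)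
  have hD0 : 0 < D := Real.sqrt_pos.2 (by positivity)
  have hD2 : D ^ 2 = S.L ^ 2 + S.σ ^ 2 := Real.sq_sqrt (by positivity)
  have hyQ : ∀ w, S.y (fun t x => G x (ζ t w)) k ∈ S.Q := fun w =>
    y_mem hQ hQc hd hA hσ hR hx₀ _ k
  have hacc : S.R k * S.stageAccuracy α
      = 2 * S.R k / r * (√((S.L ^ 2 + S.σ ^ 2) * S.A / (2 * S.μd)) + S.σ * √(3 * ℓ)) := by
    simp only [stageAccuracy, noiseFactor, ← hℓ, ← hr]; ring
  -- In the first case the noise allowance already exceeds the trivial bound `2 R L` on the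
  -- variation of `f`, so failure is impossible. In the second one, `ℓ < (N₀ + 1) L² / (3 σ²)` is
  -- what gives the requirement `τ² ℓ ≤ n / 192` of the Chernoff weights.
  rcases le_or_gt (((S.N₀ : ℝ) + 1) * S.L ^ 2) (3 * ℓ * S.σ ^ 2) with hcase | hcase
  · refine (measure_mono_null (fun w hw => ?_) (measure_empty (μ := P))).le.trans zero_le
    exfalso
    have h1 := y_succ_mem hQ hQc hd hA hσ hR (hyQ w)
    obtain ⟨g, hg1, hg2⟩ := hL _ h1.1
    have h2 := hg2 (c w) (hcmem w).1
    set Y := S.y (fun t x => G x (ζ t w)) (k + 1)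
    have h3 : ‖c w - Y‖ ≤ 2 * S.R k := by
      rw [← dist_eq_norm]
      have := dist_triangle_right (c w) Y (S.y (fun t x => G x (ζ t w)) k)
      have h4 := mem_closedBall.1 (hcmem w).2
      have h5 := mem_closedBall.1 h1.2
      linarith
    have h4 : -(g (c w - Y)) ≤ S.L * (2 * S.R k) := by
      refine (neg_le_abs _).trans ((g.le_opNorm _).trans ?_)
      exact mul_le_mul hg1 h3 (norm_nonneg _) ((norm_nonneg _).trans hg1)
    have h5 : S.L * r ≤ S.σ * √(3 * ℓ) := by
      have h6 : (S.L * r) ^ 2 ≤ (S.σ * √(3 * ℓ)) ^ 2 := by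
        rw [mul_pow, mul_pow, hr2, Real.sq_sqrt (by positivity)]; linarith
      exact abs_le_of_sq_le_sq' h6 (by positivity) |>.2
    have h6 : S.L * (2 * S.R k) ≤ S.R k * S.stageAccuracy α := by
      rw [hacc]
      calc S.L * (2 * S.R k) = 2 * S.R k / r * (S.L * r) := by field_simp
        _ ≤ _ := by
          refine mul_le_mul_of_nonneg_left (h5.trans ?_) (by positivity)
          have := Real.sqrt_nonneg ((S.L ^ 2 + S.σ ^ 2) * S.A / (2 * S.μd))
          linarith
    have h7 : S.R k * S.stageAccuracy α < f Y - f (c w) := hw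
    linarith
  set τ := S.σ * √(S.A / (2 * S.μd)) / (D * r) with hτ
  have hτ0 : 0 ≤ τ := by positivity
  have hκ : √(S.A / (2 * S.μd)) ≤ r / 8 := by
    rw [Real.sqrt_le_left (by positivity), div_pow, hr2]; linarith
  have hτ1 : τ ≤ S.σ / (8 * D) := by
    rw [hτ, div_le_div_iff₀ (by positivity) (by positivity)]
    have : 0 < S.σ * D := by positivity
    nlinarith
  have hτ8 : τ ≤ 1 / 8 := by
    refine hτ1.trans ?_
    rw [div_le_div_iff₀ (by positivity) (by positivity)]
    have : S.σ ≤ D := Real.le_sqrt_of_sq_le (by nlinarith [sq_nonneg S.L])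
    linarith
  have hτℓ : τ ^ 2 * ℓ ≤ ((S.N₀ + 1 : ℕ) : ℝ) / 192 := by
    have h1 : τ ^ 2 ≤ (S.σ / (8 * D)) ^ 2 := pow_le_pow_left₀ hτ0 hτ1 2
    rw [div_pow S.σ, mul_pow 8, hD2] at h1
    refine (mul_le_mul_of_nonneg_right h1 hα.le).trans ?_
    rw [div_mul_eq_mul_div, div_le_div_iff₀ (by positivity) (by norm_num)]
    push_cast
    have : 0 ≤ ((S.N₀ : ℝ) + 1) * S.σ ^ 2 := by positivity
    nlinarith
  obtain ⟨l, C₀, C₁, C₂, hl, hC₀, hC₁, hCn, hexp⟩ :=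
    exists_chernoff_weights (Nat.succ_pos S.N₀) hα hτ0 hτ8 hτℓ
  let ξ : ℕ → Ω → (E →L[ℝ] ℝ) := fun i => S.noise P ℱ G ζ (t + i)
  let a : ℕ → Ω → (E →L[ℝ] ℝ) := fun i => P[S.observation G ζ (t + i) | ℱ (t + i)]
  -- Both the half-step prox-point and the comparator are known before the call, so the pairing with
  -- the noise has conditional mean zero. Both lie in a ball of radius `R`, hence the norm bound `2
  -- R` and `Y² ≤ 4 Z`.
  let u : ℕ → Ω → E := fun i w => proxMap S.Q S.d (S.y (fun t x => G x (ζ t w)) k) (S.R k)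
    (S.β k) (-(S.run (fun t x => G x (ζ t w)) k i).1 - a i w) - c w
  have hlt : ∀ i < S.N₀ + 1, t + i < S.m * (S.N₀ + 1) := by
    intro i hi
    have : (k + 1) * (S.N₀ + 1) ≤ S.m * (S.N₀ + 1) := Nat.mul_le_mul_right _ hk
    rw [add_mul] at this
    omega
  have hy := stronglyMeasurable_y hQ hQc hd hA hσ hR hx₀ hG.measurable hG.adapted k
  have hrun := stronglyMeasurable_run hQ hQc hd hA hσ hR hx₀ hG.measurable hG.adapted hy
  have ha : ∀ i, StronglyMeasurable[ℱ (t + i)] (a i) := fun i => stronglyMeasurable_condExp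
  have hu : ∀ i, StronglyMeasurable[ℱ (t + i)] (u i) := fun i =>
    (stronglyMeasurable_proxMap hQ hQc hd hRk hβk (hy.mono (ℱ.mono (by omega))) hyQ
      ((hrun i).1.neg.sub (ha i))).sub (hc.mono (ℱ.mono (by omega)))
  have hu2 : ∀ i w, ‖u i w‖ ≤ 2 * S.R k := by
    intro i w
    have h1 := (proxMap_spec (β := S.β k) hQ hd hRk (hyQ w)
      (-(S.run (fun t x => G x (ζ t w)) k i).1 - a i w)).1.2
    have h2 := (hcmem w).2
    rw [mem_closedBall] at h1 h2
    rw [← dist_eq_norm]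
    exact (dist_triangle_right _ _ _).trans (by linarith)
  have hobs : ∀ i < S.N₀ + 1, StronglyMeasurable[ℱ (t + i + 1)] (S.observation G ζ (t + i)) := by
    intro i hi
    have : S.observation G ζ (t + i) = fun w => Function.uncurry G
        ((S.run (fun t x => G x (ζ t w)) k i).2, ζ (t + i) w) := by
      ext1 w
      simp only [observation, randomPoint, ht, searchPoint_eq_run _ k hi, Function.uncurry]
    rw [this]
    exact hG.measurable.comp_measurable
      (((hrun i).2.measurable.mono (ℱ.mono (by omega)) le_rfl).prodMk (hG.adapted _))
  have hξ : ∀ i < S.N₀ + 1, StronglyMeasurable[ℱ (t + i + 1)] (ξ i) := fun i hi =>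
    (hobs i hi).sub ((ha i).mono (ℱ.mono (by omega)))
  let Zf : ℕ → Ω → ℝ := fun i w => ‖ξ i w‖ ^ 2 / S.σ ^ 2
  let Y : ℕ → Ω → ℝ := fun i w => -(ξ i w (u i w)) / (S.R k * S.σ)
  let W : ℕ → Ω → ℝ := fun i w => τ * (Zf i w - 1) + Y i w
  have hYZ : ∀ i w, Y i w ^ 2 ≤ 4 * Zf i w := by
    intro i w
    have h1 : |ξ i w (u i w)| ≤ ‖ξ i w‖ * (2 * S.R k) :=
      ((ξ i w).le_opNorm _).trans (mul_le_mul_of_nonneg_left (hu2 i w) (norm_nonneg _))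
    have h2 : (ξ i w (u i w)) ^ 2 ≤ (‖ξ i w‖ * (2 * S.R k)) ^ 2 := by
      rw [← sq_abs]; exact pow_le_pow_left₀ (abs_nonneg _) h1 2
    simp only [Y, Zf]
    rw [div_pow, neg_sq, div_le_iff₀ (by positivity)]
    refine h2.trans (le_of_eq ?_)
    field_simp
    ring
  have hpair : ∀ i < S.N₀ + 1, Integrable (fun w => ξ i w (u i w)) P ∧
      P[fun w => ξ i w (u i w) | ℱ (t + i)] =ᵐ[P] 0 := fun i hi =>
    condExp_sub_condExp_apply (ℱ.le _) (hG.integrable _ (hlt i hi)) (hu i) (hu2 i)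
  -- The pointwise majorant is linear in `exp Z` and `Y`, so its conditional expectation is bounded
  -- using only the two oracle assumptions.
  let g : ℕ → Ω → ℝ := fun i => (fun _ => C₀) + C₁ • (fun w => Real.exp (Zf i w))
    + (C₂ * (-(S.R k * S.σ)⁻¹)) • fun w => ξ i w (u i w)
  have hge : ∀ i w, g i w = C₀ + C₁ * Real.exp (Zf i w) + C₂ * Y i w := by
    intro i w
    simp only [g, Y, Pi.add_apply, Pi.smul_apply, smul_eq_mul]
    ring
  have hbound := measure_sum_ge_le (P := P) ℱ t (S.N₀ + 1) W g
    (T := 2 * √(3 * ((S.N₀ + 1 : ℕ) : ℝ) * ℓ)) (C := C₀ + C₁ * Real.exp 1) hl (by positivity)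
    (fun i hi => by
      have h1 : StronglyMeasurable[ℱ (t + i + 1)] fun w => ξ i w (u i w) :=
        (ContinuousLinearMap.id ℝ (E →L[ℝ] ℝ)).continuous₂.comp_stronglyMeasurable
          ((hξ i hi).prodMk ((hu i).mono (ℱ.mono (by omega))))
      have h2 := (hξ i hi).norm.measurable
      exact ((((h2.pow_const 2).div_const _).sub_const 1).const_mul τ).add
        (h1.measurable.neg.div_const _))
    (fun i hi => ((integrable_const C₀).add ((hG.integrable_exp _ (hlt i hi)).smul C₁)).add
      ((hpair i hi).1.smul _))
    (fun i hi w => by rw [hge]; exact hexp _ _ (hYZ i w))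
    (fun i hi => by
      have i1 : Integrable (fun w => Real.exp (Zf i w)) P := hG.integrable_exp _ (hlt i hi)
      have e1 := condExp_add ((integrable_const C₀).add (i1.smul C₁))
        ((hpair i hi).1.smul (C₂ * (-(S.R k * S.σ)⁻¹))) (ℱ (t + i))
      have e2 := condExp_add (integrable_const (μ := P) C₀) (i1.smul C₁) (ℱ (t + i))
      have e3 := condExp_smul (μ := P) C₁ (fun w => Real.exp (Zf i w)) (ℱ (t + i))
      have e4 := condExp_smul (μ := P) (C₂ * (-(S.R k * S.σ)⁻¹)) (fun w => ξ i w (u i w))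
        (ℱ (t + i))
      have e5 := hG.subGaussian _ (hlt i hi)
      filter_upwards [e1, e2, e3, e4, e5, (hpair i hi).2] with w w1 w2 w3 w4 w5 w6
      change (P[(fun _ => C₀) + C₁ • (fun w => Real.exp (Zf i w))
        + (C₂ * (-(S.R k * S.σ)⁻¹)) • (fun w => ξ i w (u i w)) | ℱ (t + i)]) w ≤ _
      rw [w1, Pi.add_apply, w2, Pi.add_apply, w3, w4, condExp_const (ℱ.le _)]
      simp only [Pi.smul_apply, w6, Pi.zero_apply, smul_eq_mul, mul_zero, add_zero]
      exact add_le_add_right (mul_le_mul_of_nonneg_left w5 hC₁) _)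
  have hsub : ∀ᵐ w ∂P,
      S.R k * S.stageAccuracy α < f (S.y (fun t x => G x (ζ t w)) (k + 1)) - f (c w) →
      2 * √(3 * ((S.N₀ + 1 : ℕ) : ℝ) * ℓ) ≤ ∑ i ∈ Finset.range (S.N₀ + 1), W i w := by
    have hun : ∀ᵐ w ∂P, ∀ i, i < S.N₀ + 1 →
        a i w ∈ boundedSubdifferential S.Q f S.L (S.randomPoint G ζ (t + i) w) := by
      rw [ae_all_iff]
      intro i
      by_cases hi : i < S.N₀ + 1
      · filter_upwards [hG.unbiased _ (hlt i hi)] with w hw _ using hw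
      · exact Filter.Eventually.of_forall fun w h => absurd h hi
    filter_upwards [hun] with w hw hbad
    have key := dualAveragingOutput_sub_le_noise hf hQ hd hA hσ hRk (hyQ w) (γ := S.γ k) rfl
      S.N₀ (fun j x => G x (ζ (t + j) w)) (fun i => a i w) (fun i => ξ i w)
      (fun i hi => by
        have e : S.observation G ζ (t + i) w = a i w + ξ i w := by
          simp only [a, ξ, noise]; abel
        rw [← e]
        simp only [observation, randomPoint, ht, searchPoint_eq_run _ k hi]
        rfl)
      (fun i hi => by
        have := hw i hi
        simp only [randomPoint, ht, searchPoint_eq_run _ k hi] at this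
        exact this)
      (hcmem w)
    have key' : r ^ 2 * (f (S.y (fun t x => G x (ζ t w)) (k + 1)) - f (c w))
        ≤ 2 * S.R k * r * √((S.L ^ 2 + S.σ ^ 2) * S.A / (2 * S.μd))
          + S.R k * S.σ * ∑ i ∈ Finset.range (S.N₀ + 1), W i w := by
      rw [hr2]; exact key
    have h1 := mul_lt_mul_of_pos_left hbad (by positivity : 0 < r ^ 2)
    have e1 : r ^ 2 * (S.R k * S.stageAccuracy α)
        = 2 * S.R k * r * √((S.L ^ 2 + S.σ ^ 2) * S.A / (2 * S.μd))
          + S.R k * S.σ * (2 * (r * √(3 * ℓ))) := by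
      rw [hacc]; field_simp
    have e2 : √(3 * ((S.N₀ + 1 : ℕ) : ℝ) * ℓ) = r * √(3 * ℓ) := by
      rw [hr, ← Real.sqrt_mul (by positivity)]; congr 1; push_cast; ring
    rw [e2]
    have h2 : S.R k * S.σ * (2 * (r * √(3 * ℓ)))
        < S.R k * S.σ * ∑ i ∈ Finset.range (S.N₀ + 1), W i w := by linarith
    exact (lt_of_mul_lt_mul_left h2 (by positivity)).le
  refine (measure_mono_ae hsub).trans (hbound.trans (ENNReal.ofReal_le_ofReal ?_))
  refine (mul_le_mul_of_nonneg_right hCn (Real.exp_pos _).le).trans (le_of_eq ?_)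
  rw [← Real.exp_add]
  congr 1
  ring

end AdaptiveScheme

/-! ### Deterministic tracking of the distance to the minimizer. -/

section Tracking

variable {E : Type*} [NormedAddCommGroup E] {f : E → ℝ} {ρ μ R₀ a t : ℝ}
  {xs : E} {y : ℕ → E} {m : ℕ}

/-- As long as the radius is not too small, the points stay in the balls around the minimizer. -/
theorem norm_sub_le_of_two_pow_le (hρ : 2 ≤ ρ) (hμ : 0 < μ) (hR : 0 < R₀) (ha : 0 < a) (ht : 0 < t)
    (hta : t ^ (ρ - 1) = μ * R₀ ^ (ρ - 1) / (2 * a))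
    (hgrow : ∀ j, 1 / 2 * μ * ‖y j - xs‖ ^ ρ ≤ f (y j) - f xs) (h0 : ‖xs - y 0‖ ≤ R₀)
    (hin : ∀ j < m, ‖xs - y j‖ ≤ R₀ / 2 ^ j → f (y (j + 1)) - f xs ≤ R₀ / 2 ^ j * a)
    (j : ℕ) (hj : j ≤ m) (hjt : j = 0 ∨ 2 ^ (j + 1) ≤ t) : ‖xs - y j‖ ≤ R₀ / 2 ^ j := by
  induction j with
  | zero => simpa using h0
  | succ j ih =>
    have hjt : (2 : ℝ) ^ (j + 2) ≤ t := by simpa using hjt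
    have h1 := hin j (by omega) (ih (by omega) (Or.inr (le_trans
      (pow_le_pow_right₀ one_le_two (by omega)) hjt)))
    by_contra! h
    rw [norm_sub_rev] at h
    set r := R₀ / 2 ^ (j + 1) with hr
    have hr0 : 0 < r := by positivity
    have h2 : r ^ ρ < ‖y (j + 1) - xs‖ ^ ρ := Real.rpow_lt_rpow hr0.le h (by linarith)
    have h3 : 1 / 2 * μ * r ^ ρ < R₀ / 2 ^ j * a :=
      (mul_lt_mul_of_pos_left h2 (by positivity)).trans_le ((hgrow (j + 1)).trans h1)
    have h4 : R₀ / 2 ^ j = 2 * r := by rw [hr, pow_succ]; field_simp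
    have h5 : r ^ ρ = r * r ^ (ρ - 1) := by
      rw [Real.rpow_sub_one hr0.ne']; field_simp
    have h6 : r ^ (ρ - 1) = R₀ ^ (ρ - 1) / (2 ^ (j + 1)) ^ (ρ - 1) :=
      Real.div_rpow hR.le (by positivity) _
    have h7 : μ * r ^ (ρ - 1) < 4 * a := by
      rw [h4, h5] at h3
      have : r * (μ * r ^ (ρ - 1)) < r * (4 * a) := by linarith
      exact lt_of_mul_lt_mul_left this hr0.le
    -- The parameter `t` encodes the thresholds: `2 ^ k ≤ t` is equivalent to `μ_k ≤ μ`. Leaving the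
    -- ball would force this inequality, whereas the base is at least 2 and `ρ - 1 ≥ 1`.
    have h8 : (t / 2 ^ (j + 1)) ^ (ρ - 1) < 2 := by
      rw [Real.div_rpow ht.le (by positivity), hta]
      rw [h6] at h7
      rw [div_div, div_lt_iff₀ (by positivity)]
      rw [mul_div_assoc', div_lt_iff₀ (by positivity)] at h7
      linarith
    have h9 : (2 : ℝ) ≤ t / 2 ^ (j + 1) := by
      rw [le_div_iff₀ (by positivity)]
      rw [pow_succ] at hjt
      linarith
    have h10 : t / 2 ^ (j + 1) ≤ (t / 2 ^ (j + 1)) ^ (ρ - 1) :=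
      Real.self_le_rpow_of_one_le (by linarith) (by linarith)
    linarith

/-- After a stage that starts close to the minimizer, the later stages lose little. -/
theorem sub_le_of_norm_sub_le (ha : 0 ≤ a) (hR : 0 ≤ R₀)
    (hin : ∀ j < m, ‖xs - y j‖ ≤ R₀ / 2 ^ j → f (y (j + 1)) - f xs ≤ R₀ / 2 ^ j * a)
    (hout : ∀ j < m, ¬‖xs - y j‖ ≤ R₀ / 2 ^ j → f (y (j + 1)) - f (y j) ≤ R₀ / 2 ^ j * a)
    {K : ℕ} (hK : ‖xs - y K‖ ≤ R₀ / 2 ^ K) (i : ℕ) (hi : K + i < m) :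
    f (y (K + i + 1)) - f xs ≤ (2 * (R₀ / 2 ^ K) - R₀ / 2 ^ (K + i)) * a := by
  induction i with
  | zero =>
    have := hin K (by omega) hK
    rw [add_zero]
    linarith
  | succ i ih =>
    have ih := ih (by omega)
    have e : R₀ / 2 ^ (K + i) = 2 * (R₀ / 2 ^ (K + (i + 1))) := by
      rw [← add_assoc, pow_succ]; field_simp
    -- If the minimizer is in the ball, the bound starts afresh from a radius at most `R_K`.
    -- Otherwise the loss adds up, and `-R_j + R_{j+1} = -R_{j+1}` closes the induction.
    by_cases h : ‖xs - y (K + (i + 1))‖ ≤ R₀ / 2 ^ (K + (i + 1))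
    · have h1 := hin _ (by omega) h
      have h2 : R₀ / 2 ^ (K + (i + 1)) ≤ R₀ / 2 ^ K :=
        div_le_div_of_nonneg_left hR (by positivity)
          (pow_le_pow_right₀ one_le_two (by omega))
      nlinarith
    · have h1 := hout _ (by omega) h
      rw [e] at ih
      have : K + i + 1 = K + (i + 1) := by ring
      rw [this] at ih
      linarith

/-- The switch occurs at the least `K` with `t ≤ 2 ^ (K + 2)`. By minimality all points up to `y K`
are still in their balls, and by the choice of `K` the later total `2 R_K a` is at most `8 R₀ a /
t`. -/
theorem sub_le_of_le_two_pow (hρ : 2 ≤ ρ) (hμ : 0 < μ) (hR : 0 < R₀) (ha : 0 < a) (ht : 0 < t)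
    (hta : t ^ (ρ - 1) = μ * R₀ ^ (ρ - 1) / (2 * a))
    (hgrow : ∀ j, 1 / 2 * μ * ‖y j - xs‖ ^ ρ ≤ f (y j) - f xs) (h0 : ‖xs - y 0‖ ≤ R₀)
    (hin : ∀ j < m, ‖xs - y j‖ ≤ R₀ / 2 ^ j → f (y (j + 1)) - f xs ≤ R₀ / 2 ^ j * a)
    (hout : ∀ j < m, ¬‖xs - y j‖ ≤ R₀ / 2 ^ j → f (y (j + 1)) - f (y j) ≤ R₀ / 2 ^ j * a)
    (hm : 1 ≤ m) (htm : t ≤ 2 ^ (m + 2)) : f (y m) - f xs ≤ 8 * R₀ * a / t := by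
  classical
  have hex : ∃ K : ℕ, t ≤ 2 ^ (K + 2) := ⟨m, htm⟩
  set K := Nat.find hex with hK
  have hKt : t ≤ 2 ^ (K + 2) := Nat.find_spec hex
  have hKm : K ≤ m := Nat.find_min' hex htm
  have hKt' : ∀ j ≤ K, j = 0 ∨ (2 : ℝ) ^ (j + 1) ≤ t := by
    intro j hj
    rcases Nat.eq_zero_or_pos j with h | h
    · exact Or.inl h
    · have := Nat.find_min hex (m := j - 1) (by omega)
      rw [not_le, show j - 1 + 2 = j + 1 by omega] at this
      exact Or.inr this.le
  have h8 : 2 * (R₀ / 2 ^ K) * a ≤ 8 * R₀ * a / t := by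
    rw [le_div_iff₀ ht]
    have e : 8 * R₀ * a = 2 * (R₀ / 2 ^ K) * a * 2 ^ (K + 2) := by
      rw [pow_add]; field_simp; ring
    rw [e]
    exact mul_le_mul_of_nonneg_left hKt (by positivity)
  rcases hKm.lt_or_eq with h | h
  · have hb := norm_sub_le_of_two_pow_le hρ hμ hR ha ht hta hgrow h0 hin K hKm (hKt' K le_rfl)
    have := sub_le_of_norm_sub_le ha.le hR.le hin hout hb (m - 1 - K) (by omega)
    rw [show K + (m - 1 - K) + 1 = m by omega] at this
    have hpos : 0 ≤ R₀ / 2 ^ (K + (m - 1 - K)) * a := by positivity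
    linarith
  -- For `K = m` no stage starts at `y K`; the last stage starts in its ball and gives `R_{m-1} a =
  -- 2 R_m a` directly.
  · have hb := norm_sub_le_of_two_pow_le hρ hμ hR ha ht hta hgrow h0 hin (m - 1) (by omega)
      (hKt' _ (by omega))
    have := hin (m - 1) (by omega) hb
    rw [show m - 1 + 1 = m by omega] at this
    have e : R₀ / 2 ^ (m - 1) = 2 * (R₀ / 2 ^ K) := by
      rw [h]
      obtain ⟨j, rfl⟩ : ∃ j, m = j + 1 := ⟨m - 1, by omega⟩
      rw [Nat.add_sub_cancel, pow_succ]; field_simp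
    rw [e] at this
    linarith

theorem sub_le_of_two_pow_le (hρ : 2 ≤ ρ) (hμ : 0 < μ) (hR : 0 < R₀) (ha : 0 < a) (ht : 0 < t)
    (hta : t ^ (ρ - 1) = μ * R₀ ^ (ρ - 1) / (2 * a))
    (hgrow : ∀ j, 1 / 2 * μ * ‖y j - xs‖ ^ ρ ≤ f (y j) - f xs) (h0 : ‖xs - y 0‖ ≤ R₀)
    (hin : ∀ j < m, ‖xs - y j‖ ≤ R₀ / 2 ^ j → f (y (j + 1)) - f xs ≤ R₀ / 2 ^ j * a)
    (hm : 1 ≤ m) (htm : 2 ^ m ≤ t) : f (y m) - f xs ≤ R₀ / 2 ^ (m - 1) * a := by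
  have hb := norm_sub_le_of_two_pow_le hρ hμ hR ha ht hta hgrow h0 hin (m - 1) (by omega)
    (Or.inr (by rwa [Nat.sub_add_cancel hm]))
  have := hin (m - 1) (by omega) hb
  rwa [Nat.sub_add_cancel hm] at this

end Tracking

/-! ### Constants of the scheme and the union bound over the stages. -/

namespace AdaptiveScheme

variable {E : Type*} [NormedAddCommGroup E] [NormedSpace ℝ E] {S : AdaptiveScheme E}

theorem noiseFactor_nonneg {E : Type*} {S : AdaptiveScheme E} (hσ : 0 < S.σ) (α : ℝ) : 0 ≤ S.noiseFactor α := by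
  unfold noiseFactor; positivity

theorem stageAccuracy_nonneg {E : Type*} {S : AdaptiveScheme E} (hσ : 0 < S.σ) (α : ℝ) : 0 ≤ S.stageAccuracy α := by
  have := S.noiseFactor_nonneg hσ α
  unfold stageAccuracy; positivity

theorem stageAccuracy_pos {E : Type*} {S : AdaptiveScheme E} (hσ : 0 < S.σ)
    (hμ : 0 < S.μd) (hA : 0 < S.A) (α : ℝ) :
    0 < S.stageAccuracy α := by
  have h1 : 0 < √((S.L ^ 2 + S.σ ^ 2) * S.A / (2 * S.μd)) := Real.sqrt_pos.2 (by positivity)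
  have h2 : 0 ≤ S.σ * √(3 * Real.log (Real.logb 2 S.N / (2 * α))) := by positivity
  unfold stageAccuracy noiseFactor
  positivity

theorem accuracy_nonneg {E : Type*} {S : AdaptiveScheme E} (hσ : 0 < S.σ) {μ : ℝ}
    (hμ : 0 < μ) (ρ α : ℝ) :
    0 ≤ S.accuracy ρ μ α := by
  have := S.noiseFactor_nonneg hσ α
  unfold accuracy; positivity

/-- This is the form `8 R₀ a / t` delivered by the tracking argument; the factor `R₀` cancels
against the one contained in `t`. -/
theorem accuracy_eq {E : Type*} {S : AdaptiveScheme E} (hσ : 0 < S.σ) {ρ μ α : ℝ}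
    (hρ : 2 ≤ ρ) (hμ : 0 < μ) (hR : 0 < S.R₀)
    (ha : 0 < S.stageAccuracy α) :
    S.accuracy ρ μ α = 8 * S.R₀ * S.stageAccuracy α
      / (μ * S.R₀ ^ (ρ - 1) / (2 * S.stageAccuracy α)) ^ (1 / (ρ - 1)) := by
  have hρ1 : 0 < ρ - 1 := by linarith
  have hρ0 : 0 < ρ := by linarith
  set F := S.noiseFactor α with hF
  have hF0 : 0 ≤ F := S.noiseFactor_nonneg hσ α
  set a := S.stageAccuracy α with haF
  set r := √((S.N₀ : ℝ) + 1) with hr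
  have hr0 : 0 < r := Real.sqrt_pos.2 (by positivity)
  have hr2 : r ^ 2 = (S.N₀ : ℝ) + 1 := Real.sq_sqrt (by positivity)
  have hFa : F = a * r / 2 := by
    rw [haF, stageAccuracy, ← hF, ← hr]; field_simp
  set e := 1 / (ρ - 1) with he
  have e1 : ρ / (ρ - 1) = 1 + e := by rw [he]; field_simp; ring
  have e2 : (16 / (((S.N₀ : ℝ) + 1) * μ ^ (2 / ρ))) ^ (ρ / (2 * (ρ - 1)))
      = (4 / r) ^ (1 + e) / μ ^ e := by
    have h1 : 16 / (((S.N₀ : ℝ) + 1) * μ ^ (2 / ρ)) = ((4 / r) / μ ^ (1 / ρ)) ^ (2 : ℝ) := by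
      rw [Real.div_rpow (by positivity) (by positivity), ← Real.rpow_mul hμ.le,
        Real.rpow_two, div_pow, hr2, one_div_mul_eq_div]
      field_simp
      norm_num
    rw [h1, ← Real.rpow_mul (by positivity)]
    have h2 : 2 * (ρ / (2 * (ρ - 1))) = 1 + e := by rw [← e1]; field_simp
    rw [h2, Real.div_rpow (by positivity) (by positivity), ← Real.rpow_mul hμ.le]
    congr 2
    rw [← e1, he]
    field_simp
  have e3 : (4 / r) ^ (1 + e) * F ^ (1 + e) = 2 * a * (2 * a) ^ e := by
    rw [← Real.mul_rpow (by positivity) hF0]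
    have : 4 / r * F = 2 * a := by rw [hFa]; field_simp; ring
    rw [this, Real.rpow_add (by positivity), Real.rpow_one]
  have e4 : (μ * S.R₀ ^ (ρ - 1) / (2 * a)) ^ e = μ ^ e * S.R₀ / (2 * a) ^ e := by
    rw [Real.div_rpow (by positivity) (by positivity), Real.mul_rpow hμ.le (by positivity),
      ← Real.rpow_mul hR.le]
    have : (ρ - 1) * e = 1 := by rw [he]; field_simp
    rw [this, Real.rpow_one]
  have hpe : 0 < (2 * a) ^ e := by positivity
  have hpμ : 0 < μ ^ e := by positivity
  rw [e4, accuracy, ← hF, e1, e2]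
  calc _ = 4 * ((4 / r) ^ (1 + e) * F ^ (1 + e)) / μ ^ e := by ring
    _ = 4 * (2 * a * (2 * a) ^ e) / μ ^ e := by rw [e3]
    _ = _ := by field_simp; ring

/-- For `A = 0` the conventions `x / 0 = 0` and `logb 2 0 = 0` make the number of stages zero. -/
theorem A_pos (hd : IsProxFunction S.d S.μd S.A) (hm : 1 ≤ S.m) : 0 < S.A := by
  have h0 : 0 ≤ S.A := by simpa [hd.zero] using hd.le 0 (by simp)
  refine h0.lt_of_ne fun h => ?_
  rw [m, ← h] at hm
  simp at hm

/-- What the choice of the number of stages gives. -/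
theorem stage_numbers [Nontrivial E] (hd : IsProxFunction S.d S.μd S.A) (hN : 4 ≤ S.N)
    (hm : 1 ≤ S.m) : 2 * ((S.m : ℝ) + 1) ≤ Real.logb 2 S.N ∧
      S.A / (2 * S.μd) ≤ ((S.N₀ : ℝ) + 1) / 64 := by
  have hA := A_pos hd hm
  have hμ := hd.pos
  have hμA := hd.le_two_mul
  have hN' : (4 : ℝ) ≤ S.N := by exact_mod_cast hN
  have hN0 : (0 : ℝ) < S.N := by linarith
  have hm' : (1 : ℝ) ≤ S.m := by exact_mod_cast hm
  set B := Real.logb 2 S.N with hB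
  have hB2 : 2 ≤ B := by
    rw [hB, Real.le_logb_iff_rpow_le one_lt_two hN0]; norm_num; exact hN
  set X := S.μd * S.N / (S.A * B) with hX
  have hX0 : 0 < X := by positivity
  have h1 : 2 * ((S.m : ℝ) + 1) ≤ Real.logb 2 X := by
    have h2 : (S.m : ℤ) = ⌊1 / 2 * Real.logb 2 X⌋ - 1 := by
      have : 1 ≤ (⌊1 / 2 * Real.logb 2 X⌋ - 1).toNat := hm
      have e : S.m = (⌊1 / 2 * Real.logb 2 X⌋ - 1).toNat := rfl
      omega
    have h3 : ((S.m + 1 : ℤ) : ℝ) ≤ 1 / 2 * Real.logb 2 X := by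
      rw [show (S.m + 1 : ℤ) = ⌊1 / 2 * Real.logb 2 X⌋ by omega]
      exact Int.floor_le _
    push_cast at h3
    linarith
  -- `μd ≤ 2 A ≤ A log₂ N`; the first inequality needs a unit vector, hence the nontriviality of
  -- `E`.
  have hXN : X ≤ S.N := by
    rw [hX, div_le_iff₀ (by positivity)]
    have : S.μd ≤ S.A * B := by nlinarith
    nlinarith
  have hBm : 2 * ((S.m : ℝ) + 1) ≤ B := h1.trans (Real.logb_le_logb_of_le one_lt_two hX0 hXN)
  refine ⟨hBm, ?_⟩
  have hX16 : 16 ≤ X := by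
    have : (4 : ℝ) ≤ Real.logb 2 X := by linarith
    rw [Real.le_logb_iff_rpow_le one_lt_two hX0] at this
    norm_num at this
    exact this
  have hNm : (S.N : ℝ) ≤ (S.N₀ + 1) * S.m := by
    have : S.N < (S.N / S.m + 1) * S.m := by
      rw [add_mul, one_mul, mul_comm]
      exact Nat.lt_mul_div_succ _ hm |>.trans_eq (by ring)
    exact_mod_cast this.le
  have hXB : X * B * S.A = S.μd * S.N := by rw [hX]; field_simp
  rw [div_le_div_iff₀ (by positivity) (by norm_num)]
  -- From `X ≥ 16`, a consequence of `m ≥ 1`, and `B ≥ 2 (m + 1)`.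
  have h4 : 32 * S.m ≤ X * B := by nlinarith
  have h5 : 32 * S.m * S.A ≤ S.μd * ((S.N₀ + 1) * S.m) := by
    have h6 := mul_le_mul_of_nonneg_right h4 hA.le
    have h7 := mul_le_mul_of_nonneg_left hNm hμ.le
    linarith
  have h8 : S.m * (32 * S.A) ≤ S.m * (S.μd * (S.N₀ + 1)) := by linarith
  have h9 : 32 * S.A ≤ S.μd * (S.N₀ + 1) := le_of_mul_le_mul_left h8 (by linarith)
  linarith

/-- With probability `1 - α`, every stage reaches its accuracy against its comparator. -/
theorem one_sub_le_measureReal [FiniteDimensional ℝ E] [Nontrivial E]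
    [MeasurableSpace E] [BorelSpace E] {Ω Z : Type*} [MeasurableSpace Ω] [MeasurableSpace Z]
    {P : Measure Ω} [IsProbabilityMeasure P] {ℱ : Filtration ℕ ‹MeasurableSpace Ω›}
    (hQ : IsClosed S.Q) (hd : IsProxFunction S.d S.μd S.A) (hσ : 0 < S.σ) (hN : 4 ≤ S.N)
    (hm : 1 ≤ S.m) (hR : 0 < S.R₀) (hx₀ : S.x₀ ∈ S.Q) {f : E → ℝ}
    (hf : ConvexOn ℝ S.Q f) (hL : ∀ x ∈ S.Q, (boundedSubdifferential S.Q f S.L x).Nonempty)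
    {G : E → Z → (E →L[ℝ] ℝ)} {ζ : ℕ → Ω → Z} (hG : S.IsOracle f P ℱ G ζ) {α : ℝ} (hα : 0 < α)
    {xs : E} (hxs : xs ∈ S.Q) {good : Set Ω}
    (hgood : ∀ w, (∀ j < S.m, ‖xs - S.y (fun t x => G x (ζ t w)) j‖ ≤ S.R j →
        f (S.y (fun t x => G x (ζ t w)) (j + 1)) - f xs ≤ S.R j * S.stageAccuracy α) →
      (∀ j < S.m, ¬‖xs - S.y (fun t x => G x (ζ t w)) j‖ ≤ S.R j →
        f (S.y (fun t x => G x (ζ t w)) (j + 1)) - f (S.y (fun t x => G x (ζ t w)) j)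
          ≤ S.R j * S.stageAccuracy α) → w ∈ good) :
    1 - α ≤ P.real good := by
  classical
  rcases le_or_gt 1 α with hα1 | hα1
  · exact (sub_nonpos.2 hα1).trans measureReal_nonneg
  have hA := A_pos hd hm
  have hμ := hd.pos
  obtain ⟨hB, hAN⟩ := stage_numbers hd hN hm
  have hm' : (1 : ℝ) ≤ S.m := by exact_mod_cast hm
  set B := Real.logb 2 S.N with hBdef
  have hB0 : 0 < B := by linarith
  have hℓ : 0 < Real.log (B / (2 * α)) := by
    refine Real.log_pos ?_
    rw [lt_div_iff₀ (by positivity)]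
    linarith
  have hexp : Real.exp (-Real.log (B / (2 * α))) = 2 * α / B := by
    rw [Real.exp_neg, Real.exp_log (by positivity), inv_div]
  let y : ℕ → Ω → E := fun j w => S.y (fun t x => G x (ζ t w)) j
  -- The comparator switches according to an event decided before the stage, so it remains
  -- predictable.
  let c : ℕ → Ω → E := fun j w => if ‖xs - y j w‖ ≤ S.R j then xs else y j w
  have hy : ∀ j, StronglyMeasurable[ℱ (j * (S.N₀ + 1))] (y j) := fun j =>
    stronglyMeasurable_y hQ hf.1 hd hA hσ hR hx₀ hG.measurable hG.adapted j
  have hc : ∀ j, StronglyMeasurable[ℱ (j * (S.N₀ + 1))] (c j) := fun j =>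
    StronglyMeasurable.ite
      (measurableSet_le (stronglyMeasurable_const.sub (hy j)).norm.measurable measurable_const)
      stronglyMeasurable_const (hy j)
  have hyQ : ∀ j w, y j w ∈ S.Q := fun j w => y_mem hQ hf.1 hd hA hσ hR hx₀ _ j
  have hcmem : ∀ j w, c j w ∈ S.Q ∩ closedBall (y j w) (S.R j) := by
    intro j w
    by_cases h : ‖xs - y j w‖ ≤ S.R j
    · simp only [c, if_pos h]
      exact ⟨hxs, by rwa [mem_closedBall, dist_eq_norm]⟩
    · simp only [c, if_neg h]
      exact ⟨hyQ j w, mem_closedBall_self (S.R_pos hR j).le⟩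
  let bad : ℕ → Set Ω := fun j => {w | S.R j * S.stageAccuracy α < f (y (j + 1) w) - f (c j w)}
  have hbad : ∀ j ∈ Finset.range S.m, P.real (bad j) ≤ 2 * α / B := fun j hj => by
    rw [← hexp]
    exact ENNReal.toReal_le_of_le_ofReal (Real.exp_pos _).le
      (measure_stage_fail_le hQ hd hA hσ hR hx₀ hf hL hG hAN hℓ (Finset.mem_range.1 hj)
        (hc j) (hcmem j))
  -- A covering suffices: subadditivity of the measure requires no measurability of `good` or of the
  -- failure sets.
  have hcover : Set.univ ⊆ good ∪ ⋃ j ∈ Finset.range S.m, bad j := by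
    intro w _
    by_cases h : ∃ j ∈ Finset.range S.m, w ∈ bad j
    · right
      obtain ⟨j, hj, hw⟩ := h
      exact Set.mem_iUnion₂.2 ⟨j, hj, hw⟩
    · left
      have hle : ∀ j < S.m, f (y (j + 1) w) - f (c j w) ≤ S.R j * S.stageAccuracy α :=
        fun j hj => not_lt.1 fun hlt => h ⟨j, Finset.mem_range.2 hj, hlt⟩
      refine hgood w (fun j hj hn => ?_) fun j hj hn => ?_
      · have := hle j hj
        simp only [c] at this
        rwa [if_pos hn] at this
      · have := hle j hj
        simp only [c] at this
        rwa [if_neg hn] at this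
  have h1 : 1 ≤ P.real good + ∑ j ∈ Finset.range S.m, P.real (bad j) :=
    calc (1 : ℝ) = P.real Set.univ := probReal_univ.symm
      _ ≤ P.real (good ∪ ⋃ j ∈ Finset.range S.m, bad j) := measureReal_mono hcover
      _ ≤ P.real good + P.real (⋃ j ∈ Finset.range S.m, bad j) := measureReal_union_le _ _
      _ ≤ _ := add_le_add_right (measureReal_biUnion_finset_le _ _) _
  -- There are `m ≤ B / 2` stages, each failing with probability at most `2 α / B`.
  have h2 : ∑ j ∈ Finset.range S.m, P.real (bad j) ≤ α := by
    refine (Finset.sum_le_sum hbad).trans ?_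
    rw [Finset.sum_const, Finset.card_range, nsmul_eq_mul, mul_div_assoc', div_le_iff₀ hB0]
    nlinarith
  linarith

end AdaptiveScheme

end

/-! ### Assembly of the two regimes. -/

theorem mainTheorem3
    {E : Type*} [NormedAddCommGroup E] [NormedSpace ℝ E] [FiniteDimensional ℝ E]
    [MeasurableSpace E] [BorelSpace E]
    {Ω Z : Type*} [MeasurableSpace Ω] [MeasurableSpace Z]
    (P : Measure Ω) [IsProbabilityMeasure P] (ℱ : Filtration ℕ ‹MeasurableSpace Ω›)
    (S : AdaptiveScheme E) (hQ : IsClosed S.Q) (hd : IsProxFunction S.d S.μd S.A)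
    (hσ : 0 < S.σ) (hN : 4 ≤ S.N) (hm : 1 ≤ S.m)
    (f : E → ℝ) (ρ μ : ℝ) (hρ : 2 ≤ ρ) (hμ : 0 < μ) (hf : UniformlyConvexOn S.Q f ρ μ)
    (hL : ∀ x ∈ S.Q, (boundedSubdifferential S.Q f S.L x).Nonempty)
    (hx₀ : S.x₀ ∈ S.Q) (xs : E) (hxs : xs ∈ S.Q) (hmin : IsMinOn f S.Q xs)
    (hR : 0 < S.R₀) (hR₀ : ‖xs - S.x₀‖ ≤ S.R₀)
    (G : E → Z → (E →L[ℝ] ℝ)) (ζ : ℕ → Ω → Z) (hG : S.IsOracle f P ℱ G ζ)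
    (α : ℝ) (hα : 0 < α) :
    (μ ≤ 2 ^ ((ρ - 1) * (S.m + 2)) * (2 * S.R₀ ^ (1 - ρ) * S.stageAccuracy α) →
      1 - α ≤ P.real {w | f (S.output fun t x => G x (ζ t w)) - f xs ≤ S.accuracy ρ μ α}) ∧
    (2 ^ ((ρ - 1) * (S.m + 2)) * (2 * S.R₀ ^ (1 - ρ) * S.stageAccuracy α) < μ →
      1 - α ≤ P.real {w | f (S.output fun t x => G x (ζ t w)) - f xs
        ≤ S.R (S.m - 1) * S.stageAccuracy α}) := by
  have hfc : ConvexOn ℝ S.Q f := hf.convexOn hμ.le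
  -- In dimension zero `μd ≤ 2 A` may fail, but then the output equals the minimizer.
  rcases subsingleton_or_nontrivial E with hE | hE
  · have hsub : ∀ {b : ℝ}, 0 ≤ b →
        1 - α ≤ P.real {w | f (S.output fun t x => G x (ζ t w)) - f xs ≤ b} := by
      intro b hb
      have : {w | f (S.output fun t x => G x (ζ t w)) - f xs ≤ b} = Set.univ := by
        refine Set.eq_univ_of_forall fun w => ?_
        rw [Set.mem_ofPred_eq, Subsingleton.elim (S.output fun t x => G x (ζ t w)) xs, sub_self]
        exact hb
      rw [this, probReal_univ]
      linarith
    exact ⟨fun _ => hsub (AdaptiveScheme.accuracy_nonneg hσ hμ ρ α), fun _ => hsub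
      (mul_nonneg (S.R_pos hR _).le (AdaptiveScheme.stageAccuracy_nonneg hσ α))⟩
  have hA := AdaptiveScheme.A_pos hd hm
  have ha := AdaptiveScheme.stageAccuracy_pos hσ hd.pos hA α
  set a := S.stageAccuracy α with hadef
  have hρ1 : 0 < ρ - 1 := by linarith
  set t := (μ * S.R₀ ^ (ρ - 1) / (2 * a)) ^ (1 / (ρ - 1)) with ht
  have ht0 : 0 < t := by positivity
  have hta : t ^ (ρ - 1) = μ * S.R₀ ^ (ρ - 1) / (2 * a) := by
    rw [ht, ← Real.rpow_mul (by positivity), one_div_mul_cancel hρ1.ne', Real.rpow_one]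
  have hthr : (2 : ℝ) ^ ((ρ - 1) * (S.m + 2)) * (2 * S.R₀ ^ (1 - ρ) * a)
      = ((2 : ℝ) ^ (S.m + 2)) ^ (ρ - 1) * (2 * a) / S.R₀ ^ (ρ - 1) := by
    have e1 : (2 : ℝ) ^ ((ρ - 1) * (S.m + 2)) = ((2 : ℝ) ^ (S.m + 2)) ^ (ρ - 1) := by
      rw [← Real.rpow_natCast, ← Real.rpow_mul zero_le_two, mul_comm]
      push_cast
      rfl
    have e2 : S.R₀ ^ (1 - ρ) = (S.R₀ ^ (ρ - 1))⁻¹ := by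
      rw [← Real.rpow_neg hR.le, neg_sub]
    rw [e1, e2]
    ring
  have hμt : μ = t ^ (ρ - 1) * (2 * a) / S.R₀ ^ (ρ - 1) := by
    rw [hta]
    field_simp
  have hgrow : ∀ w j, 1 / 2 * μ * ‖S.y (fun t x => G x (ζ t w)) j - xs‖ ^ ρ
      ≤ f (S.y (fun t x => G x (ζ t w)) j) - f xs := fun w j => by
    have := hf.add_le_of_isMinOn (by linarith) hxs hmin
      (AdaptiveScheme.y_mem hQ hfc.1 hd hA hσ hR hx₀ (fun t x => G x (ζ t w)) j)
    linarith
  have hpow : (0 : ℝ) < S.R₀ ^ (ρ - 1) := by positivity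
  constructor
  · intro h
    have htm : t ≤ 2 ^ (S.m + 2) := by
      rw [hthr, hμt, div_le_div_iff_of_pos_right hpow] at h
      exact (Real.rpow_le_rpow_iff ht0.le (by positivity) hρ1).1
        (le_of_mul_le_mul_right h (by positivity))
    rw [AdaptiveScheme.accuracy_eq hσ hρ hμ hR ha]
    exact AdaptiveScheme.one_sub_le_measureReal hQ hd hσ hN hm hR hx₀ hfc hL hG hα hxs
      fun w hin hout => sub_le_of_le_two_pow hρ hμ hR ha ht0 hta (hgrow w) hR₀ hin hout hm htm
  · intro h
    -- The hypothesis gives even `2 ^ (m + 2) < t`; `2 ^ m ≤ t` already keeps the minimizer in the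
    -- ball of the last stage.
    have htm : 2 ^ S.m ≤ t := by
      rw [hthr, hμt, div_lt_div_iff_of_pos_right hpow] at h
      exact (pow_le_pow_right₀ one_le_two (by omega)).trans
        ((Real.rpow_lt_rpow_iff (by positivity) ht0.le hρ1).1
          (lt_of_mul_lt_mul_right h (by positivity))).le
    exact AdaptiveScheme.one_sub_le_measureReal hQ hd hσ hN hm hR hx₀ hfc hL hG hα hxs
      fun w hin _ => sub_le_of_two_pow_le hρ hμ hR ha ht0 hta (hgrow w) hR₀ hin hm htm
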